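/- Say that a function $f$ has \emph{Edrei's form} on an annulus $r<|z|<R$ if there $$f(z)=Cz^je^{Az+\frac{A_0}{z}}\cdot\frac{\prod_{\mu>0}\left(1+\frac{z}{\beta_\mu}\right)}{\prod_{\nu>0}\left(1-\frac{z}{\delta_\nu}\right)}\cdot\frac{\prod_{\mu<0}\left(1+\frac{z^{-1}}{\beta_\mu}\right)}{\prod_{\nu<0}\left(1-\frac{z^{-1}}{\delta_\nu}\right)},$$ where $j\in\mathbb Z$, $A,A_0\ge 0$, $C>0$, all $\beta_\mu,\delta_\nu>0$, the indices $\mu$ and $\nu$ run over (finite, infinite or empty) intervals of $\mathbb Z$, the sums of all $1/\beta_\mu$ and of all $1/\delta_\nu$ ($\mu,\nu\neq0$) are finite, and $1/\delta_{\nu}\le r$ for $\nu<0$, $R\le\delta_\nu$ for $\nu>0$. Let $0\le r<R$, and let the series $p(z)=\sum_{k=-\infty}^{\infty}a_kz^k$ and $q(z)=\sum_{k=-\infty}^{\infty}b_kz^k$ with real coefficients converge in the common annulus $r<|z|<R$. Suppose that $p$ has Edrei's form there, and that $q$ has Edrei's form there or is identically zero. Suppose that the ratio $F(z)=q(z)/p(z)$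 can be represented in one of the following two ways. (1) $$F(z)=C\,\frac{\prod_{\mu>0}\left(1+\frac{z}{\beta_\mu}\right)}{\prod_{\nu>0}\left(1+\frac{z}{\alpha_\nu}\right)}\cdot\frac{\prod_{\mu<0}\left(1+\frac{z^{-1}}{\beta_\mu}\right)}{\prod_{\nu<0}\left(1+\frac{z^{-1}}{\alpha_\nu}\right)},\qquad C>0,$$ $$0<\cdots<\alpha_{-2}^{-1}<\beta_{-1}^{-1}<\alpha_{-1}^{-1}<\beta_1<\alpha_1<\beta_2<\alpha_2<\cdots,\qquad \sum_{\nu\ne0}\left(\alpha_\nu^{-1}+\beta_\nu^{-1}\right)<\infty.$$ Both ends of the chain may terminate: the numbers present are an initial segment (empty, finite or infinite) of $\beta_1,\alpha_1,\beta_2,\alpha_2,\dots$ and an initial segment of $\alpha_{-1}^{-1},\beta_{-1}^{-1},\alpha_{-2}^{-1},\beta_{-2}^{-1},\dots$, and the inequalities and the sum refer to the numbers present. (2) $$F(z)=C\,\frac{z+\beta_0}{z+\alpha_0}\cdot\frac{\prod_{\mu>0}\left(1+\frac{z}{\beta_\mu}\right)}{\prod_{\nu>0}\left(1+\frac{z}{\alpha_\nu}\right)},\qquad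 C\ge0,$$ $$0\le\beta_0<\alpha_0<\beta_1<\alpha_1<\cdots,\qquad \sum_{\nu>0}\left(\alpha_\nu^{-1}+\beta_\nu^{-1}\right)<\infty,$$ where the chain may terminate at any place after $\alpha_0$. Then the Hurwitz-type matrix $H(p,q)=(h_{ij})_{i,j\in\mathbb Z}$, with $h_{2k-1,j}=a_{j-k}$ and $h_{2k,j}=b_{j-k}$ for $k,j\in\mathbb Z$, is totally nonnegative: all its finite minors are nonnegative. -/

import Mathlib

noncomputable section

/-- A matrix over linearly ordered index types is totally nonnegative if each of its
(finite) minors, with rows and columns taken in increasing order, is nonnegative. -/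
def TotallyNonnegative {m n : Type*} [Preorder m] [Preorder n] (M : Matrix m n ℝ) : Prop :=
  ∀ (k : ℕ) (s : Fin k → m) (t : Fin k → n), StrictMono s → StrictMono t →
    0 ≤ (M.submatrix s t).det

/-- The Hurwitz-type matrix `H(p,q)` of `p(z) = ∑ a_k z^k` and `q(z) = ∑ b_k z^k`: row `2k - 1` is
`(a_{j-k})_j` and row `2k` is `(b_{j-k})_j`, so that the entries at `(1,1)` and `(2,1)` are
`a_0` and `b_0`. -/
def hurwitzType (a b : ℤ → ℝ) : Matrix ℤ ℤ ℝ :=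
  Matrix.of fun i j => if Odd i then a (j - (i + 1) / 2) else b (j - i / 2)

/-- The positive indices in `S`. -/
abbrev PosIdx (S : Set ℤ) : Type := {k : ℤ // k ∈ S ∧ 0 < k}

/-- The negative indices in `S`. -/
abbrev NegIdx (S : Set ℤ) : Type := {k : ℤ // k ∈ S ∧ k < 0}

/-- `∏_{k > 0} (1 + z / c_k)`, the index running over the positive elements of `S`. -/
def posProd (S : Set ℤ) (c : ℤ → ℝ) (z : ℂ) : ℂ := ∏' k : PosIdx S, (1 + z / (c k : ℂ))

/-- `∏_{k < 0} (1 + z⁻¹ / c_k)`, the index running over the negative elements of `S`. -/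
def negProd (S : Set ℤ) (c : ℤ → ℝ) (z : ℂ) : ℂ := ∏' k : NegIdx S, (1 + z⁻¹ / (c k : ℂ))

/-- The parameters `c_k` with nonzero index `k ∈ S` are positive and have a convergent sum of
reciprocals, that is, the products `posProd S c` and `negProd S c` converge absolutely. -/
structure AdmissibleParams (S : Set ℤ) (c : ℤ → ℝ) : Prop where
  pos : ∀ k ∈ S, k ≠ 0 → 0 < c k
  summable_pos : Summable fun k : PosIdx S => (c k)⁻¹
  summable_neg : Summable fun k : NegIdx S => (c k)⁻¹

/-- The parameters of a function of Edrei's form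
`C z^j e^{Az + A₀/z} ∏_{μ>0} (1 + z/β_μ) / ∏_{ν>0} (1 - z/δ_ν)
  * ∏_{μ<0} (1 + z⁻¹/β_μ) / ∏_{ν<0} (1 - z⁻¹/δ_ν)`;
the index `μ` runs over `M` and `ν` runs over `N`. -/
structure EdreiData where
  C : ℝ
  A : ℝ
  A₀ : ℝ
  j : ℤ
  M : Set ℤ
  N : Set ℤ
  β : ℤ → ℝ
  δ : ℤ → ℝ
  C_pos : 0 < C
  A_nonneg : 0 ≤ A
  A₀_nonneg : 0 ≤ A₀
  M_ordConnected : M.OrdConnected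
  N_ordConnected : N.OrdConnected
  β_admissible : AdmissibleParams M β
  δ_admissible : AdmissibleParams N δ

/-- The function determined by the parameters. -/
def EdreiData.eval (e : EdreiData) (z : ℂ) : ℂ :=
  (e.C : ℂ) * z ^ e.j * Complex.exp ((e.A : ℂ) * z + (e.A₀ : ℂ) / z) *
    (posProd e.M e.β z / ∏' ν : PosIdx e.N, (1 - z / (e.δ ν : ℂ))) *
    (negProd e.M e.β z / ∏' ν : NegIdx e.N, (1 - z⁻¹ / (e.δ ν : ℂ)))

/-- The open annulus `r < |z| < R`. -/
def annulus (r R : ℝ) : Set ℂ := {z | r < ‖z‖ ∧ ‖z‖ < R}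

/-- On the annulus `r < |z| < R` the function `f` has Edrei's form, and the annulus separates the
two kinds of poles: the poles `δ_ν` with `ν > 0` lie outside of it, and the poles `1/δ_ν` with
`ν < 0` are surrounded by it. -/
def HasEdreiForm (f : ℂ → ℂ) (r R : ℝ) : Prop :=
  ∃ e : EdreiData,
    (∀ ν ∈ e.N, 0 < ν → R ≤ e.δ ν) ∧
    (∀ ν ∈ e.N, ν < 0 → (e.δ ν)⁻¹ ≤ r) ∧
    ∀ z ∈ annulus r R, f z = e.eval z

/-- The series `∑ a_n z^n`, over all integers `n`, converges to `f` in `r < |z| < R`. -/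
def HasLaurentSeriesOn (a : ℤ → ℝ) (f : ℂ → ℂ) (r R : ℝ) : Prop :=
  ∀ z ∈ annulus r R, HasSum (fun n : ℤ => (a n : ℂ) * z ^ n) (f z)

/-- `F(z) = C ∏_{μ>0} (1 + z/β_μ) / ∏_{ν>0} (1 + z/α_ν)
  * ∏_{μ<0} (1 + z⁻¹/β_μ) / ∏_{ν<0} (1 + z⁻¹/α_ν)`, where `C > 0` and
`0 < ⋯ < 1/α_{-2} < 1/β_{-1} < 1/α_{-1} < β_1 < α_1 < β_2 < α_2 < ⋯`.
The indices `μ` run over `M` and `ν` over `N`. Each end of the chain may terminate, at any place: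
the terms that are present are the first few (none, finitely many or all) of `β_1, α_1, β_2, …`
and the first few of `1/α_{-1}, 1/β_{-1}, 1/α_{-2}, …`. -/
def HasInterlacingForm (F : ℂ → ℂ) : Prop :=
  ∃ (C : ℝ) (M N : Set ℤ) (β α : ℤ → ℝ),
    0 < C ∧ AdmissibleParams M β ∧ AdmissibleParams N α ∧
    (∀ n : ℤ, 0 < n → n ∈ N → n ∈ M ∧ β n < α n) ∧
    (∀ n : ℤ, 0 < n → n + 1 ∈ M → n ∈ N ∧ α n < β (n + 1)) ∧
    (∀ n : ℤ, n < 0 → n ∈ M → n ∈ N ∧ (β n)⁻¹ < (α n)⁻¹) ∧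
    (∀ n : ℤ, n < 0 → n - 1 ∈ N → n ∈ M ∧ (α (n - 1))⁻¹ < (β n)⁻¹) ∧
    (-1 ∈ N → 1 ∈ M → (α (-1))⁻¹ < β 1) ∧
    ∀ z : ℂ, z ≠ 0 →
      F z = (C : ℂ) * (posProd M β z / posProd N α z) * (negProd M β z / negProd N α z)

/-- `F(z) = C (z + β_0)/(z + α_0) ∏_{μ>0} (1 + z/β_μ) / ∏_{ν>0} (1 + z/α_ν)`, where `C ≥ 0` and
`0 ≤ β_0 < α_0 < β_1 < α_1 < ⋯`. The chain may terminate at any place after `α_0`. -/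
def HasMeromorphicInterlacingForm (F : ℂ → ℂ) : Prop :=
  ∃ (C : ℝ) (M N : Set ℤ) (β α : ℤ → ℝ),
    0 ≤ C ∧ AdmissibleParams M β ∧ AdmissibleParams N α ∧
    0 ∈ M ∧ 0 ∈ N ∧ 0 ≤ β 0 ∧
    (∀ n : ℤ, 0 ≤ n → n ∈ N → n ∈ M ∧ β n < α n) ∧
    (∀ n : ℤ, 0 ≤ n → n + 1 ∈ M → n ∈ N ∧ α n < β (n + 1)) ∧
    ∀ z : ℂ, z ≠ 0 →
      F z = (C : ℂ) * ((z + (β 0 : ℂ)) / (z + (α 0 : ℂ))) * (posProd M β z / posProd N α z)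

end

open Filter Topology Metric Polynomial

/-! On a circle |z| = ρ inside the annulus, the coefficients of p and q are averages of z⁻ᵏ p and
z⁻ᵏ q. The claim thus becomes one about pairs of continuous functions on that circle
(`HurwitzPair`). Such pairs survive bounded pointwise limits, because minors are polynomials in the
entries.

Two kinds of operations preserve them. Multiplying both functions by a function of Edrei's form
multiplies the matrix on the right by a totally nonnegative Toeplitz matrix; it suffices to treat
nonnegative constants, z^m, 1 + xz, 1 + x/z, 1/(1 - xz) and 1/(1 - x/z), and to pass to limits
(`IsMultiplier`). Row operations lead from (f, g) to (f, g + c f), (f, g + c z f) and (g, z f) with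
c ≥ 0. For polynomials with interlacing zeros, Euclid's algorithm uses only positive constants
(`exists_interlacing_euclid`). Read backwards, it builds every such pair from (1, 0), up to limits
(`HurwitzPair.prod_interlacing_filter`).

The link with p and q is that the poles of F are zeros of p. Functions of Edrei's form continue
analytically across the negative axis, so a negative pole of q/p can only come from a zero of p
(`EdreiData.zeroPart_neg_eq_zero`). Hence the denominator of a finite partial product of F divides
p, and the cofactor is again a multiplier. The pair (p, p times the partial product) is therefore an
interlacing polynomial pair times a multiplier (`InterlacingParams.hurwitzPair_finite`). Enlarging
the partial product gives (p, q) in the limit; ρ is chosen off the moduli of the zeros of p, so that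
F is continuous on the circle. -/

/-! ### Operations that preserve total nonnegativity -/

theorem TotallyNonnegative.of_tendsto {ι m n : Type*} [Preorder m] [Preorder n] {l : Filter ι}
    [l.NeBot] {M : ι → Matrix m n ℝ} {M' : Matrix m n ℝ}
    (h : ∀ᶠ i in l, TotallyNonnegative (M i))
    (hlim : ∀ i j, Tendsto (fun k => M k i j) l (𝓝 (M' i j))) : TotallyNonnegative M' := by
  intro k s t hs ht
  have hd : Tendsto (fun i => ((M i).submatrix s t).det) l (𝓝 ((M'.submatrix s t).det)) := by
    simp only [Matrix.det_apply, Matrix.submatrix_apply]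
    exact tendsto_finsetSum _ fun σ _ =>
      (tendsto_finsetProd _ fun i _ => hlim _ _).const_smul _
  exact ge_of_tendsto hd (h.mono fun i hi => hi k s t hs ht)

theorem TotallyNonnegative.transpose {m n : Type*} [Preorder m] [Preorder n] {M : Matrix m n ℝ}
    (h : TotallyNonnegative M) : TotallyNonnegative M.transpose := by
  intro k s t hs ht
  have := h k t s ht hs
  rwa [← Matrix.det_transpose, Matrix.transpose_submatrix] at this

theorem TotallyNonnegative.submatrix {m n m' n' : Type*} [Preorder m] [Preorder n] [Preorder m']
    [Preorder n'] {M : Matrix m n ℝ} (h : TotallyNonnegative M) {f : m' → m} {g : n' → n}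
    (hf : StrictMono f) (hg : StrictMono g) : TotallyNonnegative (M.submatrix f g) :=
  fun k s t hs ht => h k (f ∘ s) (g ∘ t) (hf.comp hs) (hg.comp ht)

/-- Reversing the order of the rows and of the columns changes the sign of a minor twice, by the
same permutation. -/
theorem TotallyNonnegative.reflect {m n m' n' : Type*} [Preorder m] [Preorder n] [Preorder m']
    [Preorder n'] {M : Matrix m n ℝ} (h : TotallyNonnegative M) {f : m' → m} {g : n' → n}
    (hf : StrictAnti f) (hg : StrictAnti g) : TotallyNonnegative (M.submatrix f g) := by
  intro k s t hs ht
  have := h k (fun i => f (s i.rev)) (fun i => g (t i.rev))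
    (fun i j hij => hf (hs (Fin.rev_lt_rev.2 hij))) (fun i j hij => hg (ht (Fin.rev_lt_rev.2 hij)))
  rw [← Matrix.det_submatrix_equiv_self Fin.revPerm] at this
  simpa [Matrix.submatrix_submatrix, Function.comp_def] using this

theorem TotallyNonnegative.mul_row {m n : Type*} [Preorder m] [Preorder n] {M : Matrix m n ℝ}
    (h : TotallyNonnegative M) {c : m → ℝ} (hc : ∀ i, 0 ≤ c i) :
    TotallyNonnegative (Matrix.of fun i j => c i * M i j) := by
  intro k s t hs ht
  have := Matrix.det_mul_column (fun i => c (s i)) (M.submatrix s t)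
  simp only [Matrix.submatrix_apply] at this
  change 0 ≤ (Matrix.of fun i j => c (s i) * M (s i) (t j)).det
  rw [this]
  exact mul_nonneg (Finset.prod_nonneg fun i _ => hc _) (h k s t hs ht)

theorem StrictMono.update_sub {k : ℕ} {t : Fin k → ℤ} (ht : StrictMono t) (j : Fin k)
    {N : ℤ} (hN : 0 ≤ N) (h : ∀ i, i < j → t i < t j - N) :
    StrictMono (Function.update t j (t j - N)) := by
  intro i i' hii
  have := ht hii
  simp only [Function.update_apply]
  split_ifs with h1 h2 h2
  · omega
  · subst h1
    omega
  · subst h2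
    exact h i hii
  · exact this

/-- Multiplication by an upper bidiagonal matrix from the right keeps total nonnegativity. -/
theorem TotallyNonnegative.add_prev_col {m : Type*} [Preorder m] {M M' : Matrix m ℤ ℝ}
    (h : TotallyNonnegative M) {x : ℤ → ℝ} (hx : ∀ j, 0 ≤ x j)
    (hM : ∀ i j, M' i j = M i j + x j * M i (j - 1)) : TotallyNonnegative M' := by
  intro k s t hs ht
  -- Mixed minors: the last `d` columns already come from `M'`. Columns are exchanged from right to
  -- left, so everything to the left of the current one still belongs to `M`.
  have key : ∀ (d : ℕ) (t : Fin k → ℤ), StrictMono t → 0 ≤ (Matrix.of fun i j : Fin k =>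
      if k ≤ j.val + d then M' (s i) (t j) else M (s i) (t j)).det := by
    intro d
    induction d with
    | zero =>
      intro t ht
      have := h k s t hs ht
      convert this using 2
      ext i j
      simp [j.isLt]
    | succ d ih =>
      intro t ht
      by_cases hd : d + 1 ≤ k
      · set j₀ : Fin k := ⟨k - (d + 1), by omega⟩ with hj₀
        have hj : ∀ j : Fin k, j ≠ j₀ → (k ≤ j.val + (d + 1) ↔ k ≤ j.val + d) := by
          intro j hne
          have : j.val ≠ k - (d + 1) := fun e => hne (Fin.ext e)
          omega
        set A : Matrix (Fin k) (Fin k) ℝ := Matrix.of fun i j : Fin k =>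
          if k ≤ j.val + d then M' (s i) (t j) else M (s i) (t j) with hA
        have e1 : (Matrix.of fun i j : Fin k =>
            if k ≤ j.val + (d + 1) then M' (s i) (t j) else M (s i) (t j)) =
            A.updateCol j₀
              ((fun i => M (s i) (t j₀)) + x (t j₀) • fun i => M (s i) (t j₀ - 1)) := by
          ext i j
          rcases eq_or_ne j j₀ with rfl | hne
          · have : k ≤ j₀.val + (d + 1) := by simp only [hj₀]; omega
            simp [this, hM]
          · simp [Matrix.updateCol_ne hne, hA, hj j hne]
        have e2 : A.updateCol j₀ (fun i => M (s i) (t j₀)) = A := by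
          ext i j
          rcases eq_or_ne j j₀ with rfl | hne
          · have : ¬ k ≤ j₀.val + d := by simp only [hj₀]; omega
            simp [this, hA]
          · simp [Matrix.updateCol_ne hne]
        rw [e1, Matrix.det_updateCol_add, Matrix.det_updateCol_smul, e2]
        refine add_nonneg (ih t ht) (mul_nonneg (hx _) ?_)
        -- The column `t j₀ - 1` of `M` is either already selected, which gives two equal columns,
        -- or can take the place of `t j₀` without disturbing the order.
        by_cases hex : ∃ i < j₀, t i = t j₀ - 1
        · obtain ⟨i, hi, hti⟩ := hex
          rw [Matrix.det_zero_of_column_eq hi.ne]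
          intro l
          have : ¬ k ≤ i.val + d := by
            have : i.val < k - (d + 1) := hi
            omega
          rw [Matrix.updateCol_ne hi.ne, Matrix.updateCol_self]
          simp [hA, this, hti]
        · push Not at hex
          have := ih _ (ht.update_sub j₀ (N := 1) (by norm_num) fun i hi => by
            have h1 := ht hi
            have h2 := hex i hi
            omega)
          have e3 : (A.updateCol j₀ fun i => M (s i) (t j₀ - 1)) = (Matrix.of fun i j : Fin k =>
              if k ≤ j.val + d then M' (s i) (Function.update t j₀ (t j₀ - 1) j)
              else M (s i) (Function.update t j₀ (t j₀ - 1) j)) := by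
            ext i j
            rcases eq_or_ne j j₀ with rfl | hne
            · have : ¬ k ≤ j₀.val + d := by simp only [hj₀]; omega
              simp [this]
            · simp [hA, hne]
          rwa [e3]
      · have := ih t ht
        convert this using 2
        ext i j
        have h1 : k ≤ j.val + (d + 1) := by omega
        have h2 : k ≤ j.val + d := by omega
        simp [h1, h2]
  have := key k t ht
  convert this using 2
  ext i j
  simp

/-- Multiplication by the inverse of the matrix with `1` on the diagonal and `-x` above it keeps
total nonnegativity. -/
theorem TotallyNonnegative.of_sub_prev_col {m : Type*} [Preorder m] {M M' : Matrix m ℤ ℝ}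
    (h : TotallyNonnegative M) {x : ℝ} (hx : 0 ≤ x)
    (hM : ∀ i j, M' i j = M i j + x * M' i (j - 1))
    (hlim : ∀ i j, Tendsto (fun N : ℕ => x ^ N * M' i (j - N)) atTop (𝓝 0)) :
    TotallyNonnegative M' := by
  intro k s t hs ht
  -- Here the first `l` columns come from `M'`: the recursion expresses a column of `M'` through one
  -- further left, so columns are exchanged from left to right.
  have key : ∀ (l : ℕ) (t : Fin k → ℤ), StrictMono t → 0 ≤ (Matrix.of fun i j : Fin k =>
      if j.val < l then M' (s i) (t j) else M (s i) (t j)).det := by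
    intro l
    induction l with
    | zero =>
      intro t ht
      simpa [Matrix.submatrix] using h k s t hs ht
    | succ l ih =>
      intro t ht
      by_cases hl : l < k
      · set j₀ : Fin k := ⟨l, hl⟩ with hj₀
        have hj : ∀ j : Fin k, j ≠ j₀ → (j.val < l + 1 ↔ j.val < l) := by
          intro j hne
          have : j.val ≠ l := fun e => hne (Fin.ext e)
          omega
        set A : Matrix (Fin k) (Fin k) ℝ := Matrix.of fun i j : Fin k =>
          if j.val < l then M' (s i) (t j) else M (s i) (t j) with hA
        set D : ℕ → ℝ := fun N => (A.updateCol j₀ fun i => M' (s i) (t j₀ - N)).det with hD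
        have hD0 : (Matrix.of fun i j : Fin k =>
            if j.val < l + 1 then M' (s i) (t j) else M (s i) (t j)).det = D 0 := by
          rw [hD]
          congr 1
          ext i j
          rcases eq_or_ne j j₀ with rfl | hne
          · simp [hj₀]
          · simp only [Matrix.updateCol_ne hne, hA, hj j hne, Matrix.of_apply]
        -- Unfolding the recursion moves the column one place to the left, at the cost of a mixed
        -- minor that is nonnegative by induction.
        have hstep : ∀ N : ℕ, (∀ i < j₀, t i < t j₀ - N) → x * D (N + 1) ≤ D N := by
          intro N hN
          have e1 : (fun i => M' (s i) (t j₀ - N)) =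
              (fun i => M (s i) (t j₀ - N)) + x • fun i => M' (s i) (t j₀ - (N + 1 : ℕ)) := by
            ext i
            simp only [Pi.add_apply, Pi.smul_apply, smul_eq_mul]
            rw [hM, show t j₀ - (N : ℤ) - 1 = t j₀ - ((N + 1 : ℕ) : ℤ) by push_cast; ring]
          have e2 : D N = (A.updateCol j₀ fun i => M (s i) (t j₀ - N)).det + x * D (N + 1) := by
            rw [hD]
            simp only
            rw [e1, Matrix.det_updateCol_add, Matrix.det_updateCol_smul]
          have := ih _ (ht.update_sub j₀ (N := N) (by positivity) hN)
          have e3 : (A.updateCol j₀ fun i => M (s i) (t j₀ - N)) = (Matrix.of fun i j : Fin k =>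
              if j.val < l then M' (s i) (Function.update t j₀ (t j₀ - N) j)
              else M (s i) (Function.update t j₀ (t j₀ - N) j)) := by
            ext i j
            rcases eq_or_ne j j₀ with rfl | hne
            · simp [hj₀]
            · simp [hA, hne]
          rw [← e3] at this
          linarith
        have hpow : ∀ N : ℕ, (∀ i < j₀, t i ≤ t j₀ - N) → x ^ N * D N ≤ D 0 := by
          intro N
          induction N with
          | zero => simp
          | succ N ihN =>
            intro hN
            have h1 := hstep N fun i hi => by have := hN i hi; push_cast at this; omega
            have h2 := ihN fun i hi => by have := hN i hi; push_cast at this; omega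
            have h3 := mul_le_mul_of_nonneg_left h1 (pow_nonneg hx N)
            rw [pow_succ, mul_assoc]
            exact h3.trans h2
        rw [hD0]
        -- The leftward motion ends when the column meets the previously selected one, where the
        -- determinant vanishes. With no column to the left it continues forever, and the decay
        -- hypothesis takes over.
        rcases Nat.eq_zero_or_pos l with hl0 | hl0
        · have hno : ∀ i, ¬ i < j₀ := fun i hi => by
            have : i.val < l := hi
            omega
          have hlim0 : Tendsto (fun N : ℕ => x ^ N * D N) atTop (𝓝 0) := by
            have e : ∀ N : ℕ, x ^ N * D N =
                (A.updateCol j₀ fun i => x ^ N * M' (s i) (t j₀ - N)).det := by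
              intro N
              rw [hD]
              simp only
              rw [← Matrix.det_updateCol_smul]
              rfl
            simp only [e]
            have hz : (A.updateCol j₀ fun _ => 0).det = 0 :=
              Matrix.det_eq_zero_of_column_eq_zero j₀ fun i => by simp
            rw [← hz]
            simp only [Matrix.det_apply]
            refine tendsto_finsetSum _ fun σ _ => Tendsto.const_smul ?_ _
            refine tendsto_finsetProd _ fun i _ => ?_
            rcases eq_or_ne i j₀ with rfl | hne
            · simpa using hlim _ _
            · simp [Matrix.updateCol_ne hne]
          exact le_of_tendsto' hlim0 fun N => hpow N fun i hi => absurd hi (hno i)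
        · set i₀ : Fin k := ⟨l - 1, by omega⟩ with hi₀
          have hlt : i₀ < j₀ := by
            change l - 1 < l
            omega
          have hle : ∀ i < j₀, t i ≤ t i₀ := fun i hi => ht.monotone (by
            have : i.val < l := hi
            change i.val ≤ l - 1
            omega)
          have hN : ((t j₀ - t i₀).toNat : ℤ) = t j₀ - t i₀ :=
            Int.toNat_of_nonneg (by have := ht hlt; omega)
          have h1 := hpow (t j₀ - t i₀).toNat fun i hi => by
            rw [hN]
            have := hle i hi
            omega
          have h2 : D (t j₀ - t i₀).toNat = 0 := by
            rw [hD]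
            simp only
            rw [Matrix.det_zero_of_column_eq hlt.ne]
            intro r
            rw [Matrix.updateCol_ne hlt.ne, Matrix.updateCol_self, hN]
            have : i₀.val < l := hlt
            simp [hA, this]
          rwa [h2, mul_zero] at h1
      · have := ih t ht
        convert this using 2
        ext i j
        have h1 : j.val < l + 1 := by omega
        have h2 : j.val < l := by omega
        simp only [h1, h2, Matrix.of_apply]
  have := key k t ht
  convert this using 2
  ext i j
  simp

/-- Negating both indices exchanges the preceding and the following column. -/
theorem TotallyNonnegative.add_next_col {M M' : Matrix ℤ ℤ ℝ}
    (h : TotallyNonnegative M) {x : ℤ → ℝ} (hx : ∀ j, 0 ≤ x j)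
    (hM : ∀ i j, M' i j = M i j + x j * M i (j + 1)) : TotallyNonnegative M' := by
  have hn : StrictAnti (fun i : ℤ => -i) := fun _ _ hij => neg_lt_neg hij
  have := TotallyNonnegative.add_prev_col (M' := M'.submatrix (fun i => -i) (fun i => -i))
    (h.reflect hn hn) (x := fun j => x (-j)) (fun j => hx _) (fun i j => by
      simp only [Matrix.submatrix_apply]
      rw [hM, show -(j - 1) = -j + 1 by ring])
  simpa [Matrix.submatrix_submatrix, Function.comp_def] using this.reflect hn hn

theorem TotallyNonnegative.of_sub_next_col {M M' : Matrix ℤ ℤ ℝ}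
    (h : TotallyNonnegative M) {x : ℝ} (hx : 0 ≤ x)
    (hM : ∀ i j, M' i j = M i j + x * M' i (j + 1))
    (hlim : ∀ i j, Tendsto (fun N : ℕ => x ^ N * M' i (j + N)) atTop (𝓝 0)) :
    TotallyNonnegative M' := by
  have hn : StrictAnti (fun i : ℤ => -i) := fun _ _ hij => neg_lt_neg hij
  have := TotallyNonnegative.of_sub_prev_col (M' := M'.submatrix (fun i => -i) (fun i => -i))
    (h.reflect hn hn) hx (fun i j => by
      simp only [Matrix.submatrix_apply]
      rw [hM, show -(j - 1) = -j + 1 by ring]) (fun i j => by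
      simp only [Matrix.submatrix_apply]
      refine (hlim (-i) (-j)).congr fun N => ?_
      rw [show -(j - (N : ℤ)) = -j + N by ring])
  simpa [Matrix.submatrix_submatrix, Function.comp_def] using this.reflect hn hn

theorem TotallyNonnegative.add_prev_row {M M' : Matrix ℤ ℤ ℝ}
    (h : TotallyNonnegative M) {x : ℤ → ℝ} (hx : ∀ j, 0 ≤ x j)
    (hM : ∀ i j, M' i j = M i j + x i * M (i - 1) j) : TotallyNonnegative M' :=
  (TotallyNonnegative.add_prev_col (M' := M'.transpose) h.transpose hx fun i j => hM j i).transpose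

theorem TotallyNonnegative.add_next_row {M M' : Matrix ℤ ℤ ℝ}
    (h : TotallyNonnegative M) {x : ℤ → ℝ} (hx : ∀ j, 0 ≤ x j)
    (hM : ∀ i j, M' i j = M i j + x i * M (i + 1) j) : TotallyNonnegative M' :=
  (TotallyNonnegative.add_next_col (M' := M'.transpose) h.transpose hx fun i j => hM j i).transpose

/-! ### Laurent coefficients as circle averages -/

/-- The real part of the `k`-th Laurent coefficient of `f`, taken over the circle `|z| = ρ`. -/
noncomputable def circleCoeff (ρ : ℝ) (f : ℂ → ℂ) (k : ℤ) : ℝ :=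
  (Real.circleAverage (fun z => z ^ (-k) * f z) 0 ρ).re

section circleCoeff

variable {ρ : ℝ} {f g : ℂ → ℂ}

theorem ne_zero_of_mem_sphere_zero (hρ : 0 < ρ) {z : ℂ} (hz : z ∈ sphere (0 : ℂ) ρ) : z ≠ 0 := by
  rintro rfl
  simp at hz
  exact hρ.ne hz

theorem circleIntegrable_zpow_mul (hρ : 0 < ρ) (hf : ContinuousOn f (sphere 0 ρ)) (k : ℤ) :
    CircleIntegrable (fun z => z ^ k * f z) 0 ρ :=
  ContinuousOn.circleIntegrable hρ.le <|
    ContinuousOn.mul (fun _ hz => (continuousAt_zpow₀ _ _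
      (Or.inl (ne_zero_of_mem_sphere_zero hρ hz))).continuousWithinAt) hf

theorem circleCoeff_congr (hρ : 0 < ρ) (h : Set.EqOn f g (sphere 0 ρ)) :
    circleCoeff ρ f = circleCoeff ρ g := by
  funext k
  unfold circleCoeff
  rw [Real.circleAverage_congr_sphere (f₂ := fun z => z ^ (-k) * g z)]
  rw [abs_of_pos hρ]
  intro z hz
  simp only [h hz]

theorem circleCoeff_add (hρ : 0 < ρ) (hf : ContinuousOn f (sphere 0 ρ))
    (hg : ContinuousOn g (sphere 0 ρ)) (k : ℤ) :
    circleCoeff ρ (fun z => f z + g z) k = circleCoeff ρ f k + circleCoeff ρ g k := by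
  unfold circleCoeff
  rw [← Complex.add_re, ← Real.circleAverage_fun_add (circleIntegrable_zpow_mul hρ hf _)
    (circleIntegrable_zpow_mul hρ hg _)]
  simp only [mul_add]

theorem circleCoeff_const_mul (c : ℝ) (k : ℤ) :
    circleCoeff ρ (fun z => (c : ℂ) * f z) k = c * circleCoeff ρ f k := by
  unfold circleCoeff
  have : (fun z : ℂ => z ^ (-k) * ((c : ℂ) * f z)) = fun z => c • (z ^ (-k) * f z) := by
    funext z
    rw [Complex.real_smul]
    ring
  rw [this, Real.circleAverage_fun_smul, Complex.smul_re, smul_eq_mul]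

theorem circleCoeff_zpow_mul (hρ : 0 < ρ) (m k : ℤ) :
    circleCoeff ρ (fun z => z ^ m * f z) k = circleCoeff ρ f (k - m) := by
  unfold circleCoeff
  rw [Real.circleAverage_congr_sphere (f₂ := fun z => z ^ (-(k - m)) * f z)]
  rw [abs_of_pos hρ]
  intro z hz
  simp only
  rw [← mul_assoc, ← zpow_add₀ (ne_zero_of_mem_sphere_zero hρ hz)]
  ring_nf

/-- Dominated convergence: a common bound on the circle replaces uniform convergence in all later
limits. -/
theorem circleCoeff_tendsto (hρ : 0 < ρ) {ι : Type*} {l : Filter ι} [l.IsCountablyGenerated]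
    {F : ι → ℂ → ℂ} (hF : ∀ i, ContinuousOn (F i) (sphere 0 ρ)) {K : ℝ}
    (hK : ∀ᶠ i in l, ∀ z ∈ sphere (0 : ℂ) ρ, ‖F i z‖ ≤ K)
    (hlim : ∀ z ∈ sphere (0 : ℂ) ρ, Tendsto (fun i => F i z) l (𝓝 (f z))) (k : ℤ) :
    Tendsto (fun i => circleCoeff ρ (F i) k) l (𝓝 (circleCoeff ρ f k)) := by
  unfold circleCoeff Real.circleAverage
  refine (Complex.continuous_re.tendsto _).comp (Tendsto.const_smul ?_ _)
  have hmem : ∀ θ, circleMap 0 ρ θ ∈ sphere (0 : ℂ) ρ := circleMap_mem_sphere _ hρ.le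
  refine intervalIntegral.tendsto_integral_filter_of_dominated_convergence
    (fun _ => ρ ^ (-k) * K) ?_ ?_ intervalIntegrable_const ?_
  · exact Eventually.of_forall fun i =>
      (circleIntegrable_zpow_mul hρ (hF i) (-k)).def'.aestronglyMeasurable
  · filter_upwards [hK] with i hi
    refine Eventually.of_forall fun θ _ => ?_
    rw [norm_mul, norm_zpow, mem_sphere_zero_iff_norm.1 (hmem θ)]
    exact mul_le_mul_of_nonneg_left (hi _ (hmem θ)) (zpow_nonneg hρ.le _)
  · exact Eventually.of_forall fun θ _ => (hlim _ (hmem θ)).const_mul _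

theorem circleCoeff_one (hρ : 0 < ρ) (k : ℤ) :
    circleCoeff ρ (fun _ => 1) k = if k = 0 then 1 else 0 := by
  have hk : Real.circleAverage (fun z : ℂ => z ^ (-k) * 1) 0 ρ = if k = 0 then 1 else 0 := by
    split_ifs with h
    · simp only [h, neg_zero, zpow_zero, mul_one]
      exact Real.circleAverage_const _ _ _
    · rw [Real.circleAverage_eq_circleIntegral hρ.ne']
      have e : (∮ z in C((0 : ℂ), ρ), (z - 0)⁻¹ • (z ^ (-k) * 1)) =
          ∮ z in C((0 : ℂ), ρ), (z - 0) ^ (-k - 1) := by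
        refine circleIntegral.integral_congr hρ.le fun z hz => ?_
        have hz0 := ne_zero_of_mem_sphere_zero hρ hz
        simp only [sub_zero, mul_one, smul_eq_mul]
        rw [zpow_sub_one₀ hz0, mul_comm]
      rw [e, circleIntegral.integral_sub_zpow_of_ne (by omega), smul_zero]
  unfold circleCoeff
  rw [hk]
  split_ifs <;> simp

theorem circleCoeff_of_hasSum (hρ : 0 < ρ) {a : ℤ → ℝ}
    (ha : ∀ z ∈ sphere (0 : ℂ) ρ, HasSum (fun n : ℤ => (a n : ℂ) * z ^ n) (f z)) :
    circleCoeff ρ f = a := by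
  have hcont : ∀ n : ℤ, ContinuousOn (fun z : ℂ => (a n : ℂ) * z ^ n) (sphere 0 ρ) := fun n =>
    continuousOn_const.mul fun _ hz => (continuousAt_zpow₀ _ _
      (Or.inl (ne_zero_of_mem_sphere_zero hρ hz))).continuousWithinAt
  -- Convergence at the single point ρ is absolute and dominates the partial sums on the whole
  -- circle.
  have hsum : Summable fun n : ℤ => |a n| * ρ ^ n := by
    have := (ha ρ (by simp [abs_of_pos hρ])).summable.norm
    refine this.congr fun n => ?_
    simp [norm_zpow, abs_of_pos hρ]
  funext k
  have h1 : Tendsto (fun s : Finset ℤ => circleCoeff ρ (fun z => ∑ n ∈ s, (a n : ℂ) * z ^ n) k)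
      atTop (𝓝 (circleCoeff ρ f k)) := by
    refine circleCoeff_tendsto hρ (K := ∑' n : ℤ, |a n| * ρ ^ n)
      (fun s => continuousOn_finsetSum _ fun n _ => hcont n) ?_ (fun z hz => ha z hz) k
    refine Eventually.of_forall fun s z hz => ?_
    refine (norm_sum_le _ _).trans ?_
    refine le_trans (le_of_eq ?_) (hsum.sum_le_tsum s fun n _ => by positivity)
    refine Finset.sum_congr rfl fun n _ => ?_
    rw [norm_mul, norm_zpow, mem_sphere_zero_iff_norm.1 hz]
    simp
  have h2 : ∀ s : Finset ℤ, circleCoeff ρ (fun z => ∑ n ∈ s, (a n : ℂ) * z ^ n) k =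
      ∑ n ∈ s, if n = k then a n else 0 := by
    intro s
    induction s using Finset.induction_on with
    | empty => simp [circleCoeff, Real.circleAverage]
    | insert n s hn ih =>
      simp only [Finset.sum_insert hn]
      rw [circleCoeff_add hρ (hcont n) (continuousOn_finsetSum _ fun n _ => hcont n), ih,
        circleCoeff_const_mul]
      have := circleCoeff_zpow_mul (f := fun _ => 1) hρ n k
      simp only [mul_one] at this
      rw [this, circleCoeff_one hρ]
      congr 1
      by_cases h : n = k
      · simp [h]
      · rw [if_neg h, if_neg (by omega), mul_zero]
  refine tendsto_nhds_unique h1 (tendsto_const_nhds.congr' ?_)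
  filter_upwards [eventually_ge_atTop {k}] with s hs
  rw [h2, Finset.sum_ite_eq', if_pos (hs (Finset.mem_singleton_self k))]

end circleCoeff

/-! ### Hurwitz pairs and row operations -/

/-- The functions `f` and `g` are continuous on the circle `|z| = ρ`, and the Hurwitz-type matrix
of their Laurent coefficients is totally nonnegative. -/
structure HurwitzPair (ρ : ℝ) (f g : ℂ → ℂ) : Prop where
  left : ContinuousOn f (sphere 0 ρ)
  right : ContinuousOn g (sphere 0 ρ)
  tnn : TotallyNonnegative (hurwitzType (circleCoeff ρ f) (circleCoeff ρ g))

theorem hurwitzType_circleCoeff (ρ : ℝ) (f g : ℂ → ℂ) (i j : ℤ) :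
    hurwitzType (circleCoeff ρ f) (circleCoeff ρ g) i j =
      circleCoeff ρ (if Odd i then f else g) (j - if Odd i then (i + 1) / 2 else i / 2) := by
  unfold hurwitzType
  split_ifs with h <;> simp [h]

namespace HurwitzPair

variable {ρ : ℝ} {f g : ℂ → ℂ}

theorem congr (hρ : 0 < ρ) (h : HurwitzPair ρ f g) {f' g' : ℂ → ℂ}
    (hf : Set.EqOn f' f (sphere 0 ρ)) (hg : Set.EqOn g' g (sphere 0 ρ)) :
    HurwitzPair ρ f' g' :=
  ⟨h.left.congr hf, h.right.congr hg, by
    rw [circleCoeff_congr hρ hf, circleCoeff_congr hρ hg]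
    exact h.tnn⟩

theorem of_tendsto (hρ : 0 < ρ) {ι : Type*} {l : Filter ι} [l.IsCountablyGenerated] [l.NeBot]
    {F G : ι → ℂ → ℂ} (h : ∀ i, HurwitzPair ρ (F i) (G i))
    (hf : ContinuousOn f (sphere 0 ρ)) (hg : ContinuousOn g (sphere 0 ρ)) {K L : ℝ}
    (hK : ∀ᶠ i in l, ∀ z ∈ sphere (0 : ℂ) ρ, ‖F i z‖ ≤ K)
    (hL : ∀ᶠ i in l, ∀ z ∈ sphere (0 : ℂ) ρ, ‖G i z‖ ≤ L)
    (hF : ∀ z ∈ sphere (0 : ℂ) ρ, Tendsto (fun i => F i z) l (𝓝 (f z)))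
    (hG : ∀ z ∈ sphere (0 : ℂ) ρ, Tendsto (fun i => G i z) l (𝓝 (g z))) :
    HurwitzPair ρ f g := by
  refine ⟨hf, hg, TotallyNonnegative.of_tendsto (l := l)
    (Eventually.of_forall fun i => (h i).tnn) ?_⟩
  intro i j
  simp only [hurwitzType_circleCoeff]
  split_ifs
  · exact circleCoeff_tendsto hρ (fun i => (h i).left) hK hF _
  · exact circleCoeff_tendsto hρ (fun i => (h i).right) hL hG _

theorem one_zero (hρ : 0 < ρ) : HurwitzPair ρ (fun _ => 1) (fun _ => 0) := by
  refine ⟨continuousOn_const, continuousOn_const, ?_⟩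
  have h0 : ∀ k, circleCoeff ρ (fun _ => 0) k = 0 := fun k => by
    simp [circleCoeff, Real.circleAverage]
  intro k s t hs ht
  -- Odd rows are unit vectors and even rows vanish. If each chosen row has its 1 in a chosen
  -- column, monotonicity makes the submatrix the identity; otherwise some row is zero.
  by_cases hodd : ∀ i, Odd (s i) ∧ (s i + 1) / 2 ∈ Set.range t
  · have hmono : StrictMono fun i => (s i + 1) / 2 := by
      intro i j hij
      obtain ⟨x, hx⟩ := (hodd i).1
      obtain ⟨y, hy⟩ := (hodd j).1
      have := hs hij
      change (s i + 1) / 2 < (s j + 1) / 2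
      omega
    have heq : (fun i => (s i + 1) / 2) = t := by
      have hcard : (Finset.univ.image t).card = k := by
        rw [Finset.card_image_of_injective _ ht.injective]
        simp
      rw [Finset.orderEmbOfFin_unique hcard (f := t) (fun i => by simp) ht]
      exact Finset.orderEmbOfFin_unique hcard (fun i => by simpa using (hodd i).2) hmono
    have : (hurwitzType (circleCoeff ρ fun _ => 1) (circleCoeff ρ fun _ => 0)).submatrix s t =
        1 := by
      ext i j
      rw [Matrix.submatrix_apply, hurwitzType_circleCoeff, if_pos (hodd i).1, if_pos (hodd i).1,
        circleCoeff_one hρ, Matrix.one_apply]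
      have h1 : (s i + 1) / 2 = t i := congrFun heq i
      rw [h1]
      refine if_congr ?_ rfl rfl
      rw [sub_eq_zero, ht.injective.eq_iff, eq_comm]
    rw [this, Matrix.det_one]
    norm_num
  · push Not at hodd
    obtain ⟨i, hi⟩ := hodd
    refine (Matrix.det_eq_zero_of_row_eq_zero i fun j => ?_).ge
    rw [Matrix.submatrix_apply, hurwitzType_circleCoeff]
    by_cases ho : Odd (s i)
    · rw [if_pos ho, if_pos ho, circleCoeff_one hρ, if_neg]
      intro h
      exact hi ho ⟨j, by omega⟩
    · rw [if_neg ho, h0]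

theorem const_mul_right (h : HurwitzPair ρ f g) {c : ℝ} (hc : 0 ≤ c) :
    HurwitzPair ρ f fun z => c * g z := by
  refine ⟨h.left, continuousOn_const.mul h.right, ?_⟩
  convert h.tnn.mul_row (c := fun i => if Odd i then 1 else c)
    (fun i => by split_ifs <;> positivity) using 1
  ext i j
  rw [Matrix.of_apply, hurwitzType_circleCoeff, hurwitzType_circleCoeff]
  split_ifs
  · rw [one_mul]
  · rw [circleCoeff_const_mul]

/-- Each row of `g` receives a multiple of the row above it, which is the row of `f` with the same
shift. -/
theorem add_const_mul (hρ : 0 < ρ) (h : HurwitzPair ρ f g) {c : ℝ} (hc : 0 ≤ c) :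
    HurwitzPair ρ f fun z => g z + c * f z := by
  have hcont : ContinuousOn (fun z => (c : ℂ) * f z) (sphere 0 ρ) :=
    continuousOn_const.mul h.left
  refine ⟨h.left, h.right.add hcont, ?_⟩
  refine h.tnn.add_prev_row (x := fun i => if Odd i then 0 else c)
    (fun i => by split_ifs <;> positivity) fun i j => ?_
  rw [hurwitzType_circleCoeff, hurwitzType_circleCoeff, hurwitzType_circleCoeff]
  by_cases ho : Odd i
  · simp [ho]
  · have ho' : Odd (i - 1) := by
      rw [Int.not_odd_iff_even] at ho
      exact ho.sub_odd odd_one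
    simp only [ho, ho', if_true, if_false]
    rw [circleCoeff_add hρ h.right hcont, circleCoeff_const_mul]
    simp

/-- The coefficients of z f form the row of `f` with the next shift, directly below the row of `g`.
-/
theorem add_const_mul_id (hρ : 0 < ρ) (h : HurwitzPair ρ f g) {c : ℝ} (hc : 0 ≤ c) :
    HurwitzPair ρ f fun z => g z + c * (z * f z) := by
  have hcont : ContinuousOn (fun z => (c : ℂ) * (z * f z)) (sphere 0 ρ) :=
    continuousOn_const.mul (continuousOn_id.mul h.left)
  refine ⟨h.left, h.right.add hcont, ?_⟩
  refine h.tnn.add_next_row (x := fun i => if Odd i then 0 else c)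
    (fun i => by split_ifs <;> positivity) fun i j => ?_
  rw [hurwitzType_circleCoeff, hurwitzType_circleCoeff, hurwitzType_circleCoeff]
  by_cases ho : Odd i
  · simp [ho]
  · have ho' : Odd (i + 1) := by
      rw [Int.not_odd_iff_even] at ho
      exact ho.add_odd odd_one
    simp only [ho, ho', if_true, if_false]
    rw [circleCoeff_add hρ h.right hcont, circleCoeff_const_mul]
    have := circleCoeff_zpow_mul (f := f) hρ 1 (j - i / 2)
    simp only [zpow_one] at this
    rw [this]
    congr 3
    omega

/-- The new matrix is the old one with its rows renumbered by one. -/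
theorem flip (hρ : 0 < ρ) (h : HurwitzPair ρ f g) : HurwitzPair ρ g fun z => z * f z := by
  refine ⟨h.right, continuousOn_id.mul h.left, ?_⟩
  convert h.tnn.submatrix (f := fun i : ℤ => i + 1) (g := fun j : ℤ => j)
    (fun _ _ hij => by simpa using hij) strictMono_id using 1
  ext i j
  rw [Matrix.submatrix_apply, hurwitzType_circleCoeff, hurwitzType_circleCoeff]
  by_cases ho : Odd i
  · have ho' : ¬ Odd (i + 1) := by
      rw [Int.not_odd_iff_even]
      exact ho.add_odd odd_one
    simp only [ho, ho', if_true, if_false]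
  · have ho' : Odd (i + 1) := by
      rw [Int.not_odd_iff_even] at ho
      exact ho.add_odd odd_one
    simp only [ho, ho', if_true, if_false]
    have := circleCoeff_zpow_mul (f := f) hρ 1 (j - i / 2)
    simp only [zpow_one] at this
    rw [this]
    congr 1
    omega

end HurwitzPair

/-! ### Multipliers: elementary factors -/

/-- Multiplication of both functions by `e` keeps Hurwitz pairs on the circle `|z| = ρ`. -/
structure IsMultiplier (ρ : ℝ) (e : ℂ → ℂ) : Prop where
  cont : ContinuousOn e (sphere 0 ρ)
  mul : ∀ f g, HurwitzPair ρ f g → HurwitzPair ρ (fun z => f z * e z) (fun z => g z * e z)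

namespace IsMultiplier

variable {ρ : ℝ}

theorem congr (hρ : 0 < ρ) {e e' : ℂ → ℂ} (h : IsMultiplier ρ e)
    (he : Set.EqOn e' e (sphere 0 ρ)) : IsMultiplier ρ e' :=
  ⟨h.cont.congr he, fun f g hfg => (h.mul f g hfg).congr hρ (fun z hz => by simp only [he hz])
    (fun z hz => by simp only [he hz])⟩

theorem one : IsMultiplier ρ fun _ => 1 :=
  ⟨continuousOn_const, fun f g h => by simpa using h⟩

theorem mul' {e e' : ℂ → ℂ} (h : IsMultiplier ρ e) (h' : IsMultiplier ρ e') :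
    IsMultiplier ρ fun z => e z * e' z :=
  ⟨h.cont.mul h'.cont, fun f g hfg => by
    simpa only [mul_assoc] using h'.mul _ _ (h.mul f g hfg)⟩

theorem prod {ι : Type*} {s : Finset ι} {e : ι → ℂ → ℂ} (h : ∀ i ∈ s, IsMultiplier ρ (e i)) :
    IsMultiplier ρ fun z => ∏ i ∈ s, e i z := by
  classical
  induction s using Finset.induction_on with
  | empty => simpa using one
  | insert i s hi ih =>
    simp only [Finset.prod_insert hi]
    exact (h i (Finset.mem_insert_self _ _)).mul' (ih fun j hj => h j (Finset.mem_insert_of_mem hj))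

theorem pow {e : ℂ → ℂ} (h : IsMultiplier ρ e) (n : ℕ) : IsMultiplier ρ fun z => e z ^ n := by
  simpa using prod (s := Finset.range n) (e := fun _ => e) fun _ _ => h

theorem of_tendsto (hρ : 0 < ρ) {ι : Type*} {l : Filter ι} [l.IsCountablyGenerated] [l.NeBot]
    {F : ι → ℂ → ℂ} {e : ℂ → ℂ} (h : ∀ i, IsMultiplier ρ (F i))
    (he : ContinuousOn e (sphere 0 ρ)) {K : ℝ}
    (hK : ∀ᶠ i in l, ∀ z ∈ sphere (0 : ℂ) ρ, ‖F i z‖ ≤ K)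
    (hF : ∀ z ∈ sphere (0 : ℂ) ρ, Tendsto (fun i => F i z) l (𝓝 (e z))) :
    IsMultiplier ρ e := by
  have hb : ∀ f : ℂ → ℂ, ContinuousOn f (sphere 0 ρ) → ∃ L : ℝ, ∀ᶠ i in l,
      ∀ z ∈ sphere (0 : ℂ) ρ, ‖f z * F i z‖ ≤ L := by
    intro f hf
    obtain ⟨B, hB⟩ := (isCompact_sphere (0 : ℂ) ρ).exists_bound_of_continuousOn hf
    refine ⟨B * K, hK.mono fun i hi z hz => ?_⟩
    rw [norm_mul]
    exact mul_le_mul (hB z hz) (hi z hz) (norm_nonneg _) ((norm_nonneg _).trans (hB z hz))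
  refine ⟨he, fun f g hfg => ?_⟩
  obtain ⟨L, hL⟩ := hb f hfg.left
  obtain ⟨L', hL'⟩ := hb g hfg.right
  exact HurwitzPair.of_tendsto hρ (fun i => (h i).mul f g hfg) (hfg.left.mul he)
    (hfg.right.mul he) hL hL' (fun z hz => (hF z hz).const_mul _) fun z hz =>
    (hF z hz).const_mul _

theorem const {c : ℝ} (hc : 0 ≤ c) : IsMultiplier ρ fun _ => (c : ℂ) := by
  refine ⟨continuousOn_const, fun f g h => ⟨h.left.mul continuousOn_const,
    h.right.mul continuousOn_const, ?_⟩⟩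
  convert h.tnn.mul_row (c := fun _ => c) (fun _ => hc) using 1
  ext i j
  rw [Matrix.of_apply, hurwitzType_circleCoeff, hurwitzType_circleCoeff]
  simp only [mul_comm _ (c : ℂ)]
  split_ifs <;> rw [circleCoeff_const_mul]

theorem zpow (hρ : 0 < ρ) (m : ℤ) : IsMultiplier ρ fun z => z ^ m := by
  have hc : ContinuousOn (fun z : ℂ => z ^ m) (sphere 0 ρ) := fun z hz =>
    (continuousAt_zpow₀ _ _ (Or.inl (ne_zero_of_mem_sphere_zero hρ hz))).continuousWithinAt
  refine ⟨hc, fun f g h => ⟨h.left.mul hc, h.right.mul hc, ?_⟩⟩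
  convert h.tnn.submatrix (f := fun i : ℤ => i) (g := fun j : ℤ => j - m)
    strictMono_id (fun _ _ hij => by simpa using hij) using 1
  ext i j
  rw [Matrix.submatrix_apply, hurwitzType_circleCoeff, hurwitzType_circleCoeff]
  simp only [mul_comm _ (_ ^ m)]
  split_ifs <;> rw [circleCoeff_zpow_mul hρ] <;> congr 1 <;> ring

theorem one_add_mul (hρ : 0 < ρ) {x : ℝ} (hx : 0 ≤ x) :
    IsMultiplier ρ fun z => 1 + (x : ℂ) * z := by
  have hc : ContinuousOn (fun z : ℂ => 1 + (x : ℂ) * z) (sphere 0 ρ) := by fun_prop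
  refine ⟨hc, fun f g h => ⟨h.left.mul hc, h.right.mul hc, ?_⟩⟩
  refine h.tnn.add_prev_col (x := fun _ => x) (fun _ => hx) fun i j => ?_
  rw [hurwitzType_circleCoeff, hurwitzType_circleCoeff, hurwitzType_circleCoeff]
  have key : ∀ f : ℂ → ℂ, ContinuousOn f (sphere 0 ρ) → ∀ k,
      circleCoeff ρ (fun z => f z * (1 + x * z)) k =
        circleCoeff ρ f k + x * circleCoeff ρ f (k - 1) := by
    intro f hf k
    have e : (fun z => f z * (1 + x * z)) = fun z => f z + (x : ℂ) * (z ^ (1 : ℤ) * f z) := by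
      funext z
      rw [zpow_one]
      ring
    rw [e, circleCoeff_add hρ hf, circleCoeff_const_mul, circleCoeff_zpow_mul hρ]
    simp only [zpow_one]
    fun_prop
  split_ifs
  · rw [key f h.left, sub_right_comm]
  · rw [key g h.right, sub_right_comm]

theorem one_add_mul_inv (hρ : 0 < ρ) {x : ℝ} (hx : 0 ≤ x) :
    IsMultiplier ρ fun z => 1 + (x : ℂ) * z⁻¹ := by
  have hi : ContinuousOn (fun z : ℂ => z⁻¹) (sphere 0 ρ) :=
    continuousOn_inv₀.mono fun z hz => ne_zero_of_mem_sphere_zero hρ hz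
  have hc : ContinuousOn (fun z : ℂ => 1 + (x : ℂ) * z⁻¹) (sphere 0 ρ) := by fun_prop
  refine ⟨hc, fun f g h => ⟨h.left.mul hc, h.right.mul hc, ?_⟩⟩
  refine h.tnn.add_next_col (x := fun _ => x) (fun _ => hx) fun i j => ?_
  rw [hurwitzType_circleCoeff, hurwitzType_circleCoeff, hurwitzType_circleCoeff]
  have key : ∀ f : ℂ → ℂ, ContinuousOn f (sphere 0 ρ) → ∀ k,
      circleCoeff ρ (fun z => f z * (1 + x * z⁻¹)) k =
        circleCoeff ρ f k + x * circleCoeff ρ f (k + 1) := by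
    intro f hf k
    have e : (fun z => f z * (1 + x * z⁻¹)) = fun z => f z + (x : ℂ) * (z ^ (-1 : ℤ) * f z) := by
      funext z
      rw [zpow_neg_one]
      ring
    rw [e, circleCoeff_add hρ hf, circleCoeff_const_mul, circleCoeff_zpow_mul hρ, sub_neg_eq_add]
    simp only [zpow_neg_one]
    fun_prop
  split_ifs
  · rw [key f h.left, sub_add_eq_add_sub]
  · rw [key g h.right, sub_add_eq_add_sub]

theorem one_sub_ne_zero {w : ℂ} (hw : ‖w‖ < 1) : 1 - w ≠ 0 := by
  intro h
  rw [sub_eq_zero] at h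
  rw [← h] at hw
  simp at hw

/-- With w = xz or w = x/z this supplies the decay condition needed to invert a bidiagonal matrix.
-/
theorem circleCoeff_pow_mul_tendsto (hρ : 0 < ρ) {f w : ℂ → ℂ} (hf : ContinuousOn f (sphere 0 ρ))
    (hw : ContinuousOn w (sphere 0 ρ)) (hw1 : ∀ z ∈ sphere (0 : ℂ) ρ, ‖w z‖ < 1) (k : ℤ) :
    Tendsto (fun N : ℕ => circleCoeff ρ (fun z => w z ^ N * f z) k) atTop (𝓝 0) := by
  obtain ⟨B, hB⟩ := (isCompact_sphere (0 : ℂ) ρ).exists_bound_of_continuousOn hf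
  have h0 : circleCoeff ρ (fun _ => 0) k = 0 := by simp [circleCoeff, Real.circleAverage]
  rw [← h0]
  refine circleCoeff_tendsto hρ (K := B) (fun N => (hw.pow N).mul hf)
    (Eventually.of_forall fun N z hz => ?_) (fun z hz => ?_) k
  · change ‖w z ^ N * f z‖ ≤ B
    rw [norm_mul, norm_pow]
    exact (mul_le_of_le_one_left (norm_nonneg _)
      (pow_le_one₀ (norm_nonneg _) (hw1 z hz).le)).trans (hB z hz)
  · simpa using (tendsto_pow_atTop_nhds_zero_of_norm_lt_one (hw1 z hz)).mul_const (f z)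

/-- The function h = f/(1 - xz) satisfies h = f + xz h, which on coefficients is the recursion of
`TotallyNonnegative.of_sub_prev_col`. The condition on ρ puts the pole outside the circle, so that
the expansion goes in the right direction. -/
theorem inv_one_sub_mul (hρ : 0 < ρ) {x : ℝ} (hx : 0 ≤ x) (hx1 : x * ρ < 1) :
    IsMultiplier ρ fun z => (1 - (x : ℂ) * z)⁻¹ := by
  have hn : ∀ z ∈ sphere (0 : ℂ) ρ, ‖(x : ℂ) * z‖ < 1 := fun z hz => by
    rw [norm_mul, mem_sphere_zero_iff_norm.1 hz, Complex.norm_real, Real.norm_of_nonneg hx]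
    exact hx1
  have hc : ContinuousOn (fun z : ℂ => (1 - (x : ℂ) * z)⁻¹) (sphere 0 ρ) :=
    ContinuousOn.inv₀ (by fun_prop) fun z hz => one_sub_ne_zero (hn z hz)
  refine ⟨hc, fun f g h => ⟨h.left.mul hc, h.right.mul hc, ?_⟩⟩
  have key : ∀ f : ℂ → ℂ, ContinuousOn f (sphere 0 ρ) → ∀ k,
      circleCoeff ρ (fun z => f z * (1 - x * z)⁻¹) k =
        circleCoeff ρ f k + x * circleCoeff ρ (fun z => f z * (1 - x * z)⁻¹) (k - 1) := by
    intro f hf k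
    rw [← circleCoeff_zpow_mul hρ, ← circleCoeff_const_mul, ← circleCoeff_add hρ hf]
    · refine congrFun (circleCoeff_congr hρ fun z hz => ?_) k
      have := one_sub_ne_zero (hn z hz)
      simp only [zpow_one]
      field_simp
      ring
    · simp only [zpow_one]
      fun_prop
  have hlim : ∀ f : ℂ → ℂ, ContinuousOn f (sphere 0 ρ) → ∀ k,
      Tendsto (fun N : ℕ => x ^ N * circleCoeff ρ f (k - N)) atTop (𝓝 0) := by
    intro f hf k
    refine (circleCoeff_pow_mul_tendsto hρ hf (w := fun z => (x : ℂ) * z) (by fun_prop) hn k).congr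
      fun N => ?_
    rw [← circleCoeff_zpow_mul hρ, ← circleCoeff_const_mul]
    congr 1
    funext z
    push_cast
    rw [zpow_natCast, mul_pow]
    ring
  refine h.tnn.of_sub_prev_col hx (fun i j => ?_) fun i j => ?_
  · rw [hurwitzType_circleCoeff, hurwitzType_circleCoeff, hurwitzType_circleCoeff]
    split_ifs
    · rw [key f h.left, sub_right_comm]
    · rw [key g h.right, sub_right_comm]
  · simp only [hurwitzType_circleCoeff]
    split_ifs
    · simpa only [sub_right_comm] using
        hlim (fun z => f z * (1 - x * z)⁻¹) (h.left.mul hc) (j - (i + 1) / 2)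
    · simpa only [sub_right_comm] using
        hlim (fun z => g z * (1 - x * z)⁻¹) (h.right.mul hc) (j - i / 2)

theorem inv_one_sub_mul_inv (hρ : 0 < ρ) {x : ℝ} (hx : 0 ≤ x) (hx1 : x < ρ) :
    IsMultiplier ρ fun z => (1 - (x : ℂ) * z⁻¹)⁻¹ := by
  have hi : ContinuousOn (fun z : ℂ => z⁻¹) (sphere 0 ρ) :=
    continuousOn_inv₀.mono fun z hz => ne_zero_of_mem_sphere_zero hρ hz
  have hn : ∀ z ∈ sphere (0 : ℂ) ρ, ‖(x : ℂ) * z⁻¹‖ < 1 := fun z hz => by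
    rw [norm_mul, norm_inv, mem_sphere_zero_iff_norm.1 hz, Complex.norm_real,
      Real.norm_of_nonneg hx, ← div_eq_mul_inv, div_lt_one hρ]
    exact hx1
  have hc : ContinuousOn (fun z : ℂ => (1 - (x : ℂ) * z⁻¹)⁻¹) (sphere 0 ρ) :=
    ContinuousOn.inv₀ (by fun_prop) fun z hz => one_sub_ne_zero (hn z hz)
  refine ⟨hc, fun f g h => ⟨h.left.mul hc, h.right.mul hc, ?_⟩⟩
  have key : ∀ f : ℂ → ℂ, ContinuousOn f (sphere 0 ρ) → ∀ k,
      circleCoeff ρ (fun z => f z * (1 - x * z⁻¹)⁻¹) k =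
        circleCoeff ρ f k + x * circleCoeff ρ (fun z => f z * (1 - x * z⁻¹)⁻¹) (k + 1) := by
    intro f hf k
    rw [← sub_neg_eq_add k 1, ← circleCoeff_zpow_mul hρ, ← circleCoeff_const_mul,
      ← circleCoeff_add hρ hf]
    · refine congrFun (circleCoeff_congr hρ fun z hz => ?_) k
      have h1 := one_sub_ne_zero (hn z hz)
      simp only [zpow_neg_one]
      generalize z⁻¹ = w at h1
      field_simp
      ring
    · simp only [zpow_neg_one]
      fun_prop
  have hlim : ∀ f : ℂ → ℂ, ContinuousOn f (sphere 0 ρ) → ∀ k,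
      Tendsto (fun N : ℕ => x ^ N * circleCoeff ρ f (k + N)) atTop (𝓝 0) := by
    intro f hf k
    refine (circleCoeff_pow_mul_tendsto hρ hf (w := fun z => (x : ℂ) * z⁻¹) (by fun_prop) hn
      k).congr fun N => ?_
    rw [← sub_neg_eq_add k (N : ℤ), ← circleCoeff_zpow_mul hρ, ← circleCoeff_const_mul]
    congr 1
    funext z
    push_cast
    rw [zpow_neg, zpow_natCast, mul_pow, inv_pow]
    ring
  refine h.tnn.of_sub_next_col hx (fun i j => ?_) fun i j => ?_
  · rw [hurwitzType_circleCoeff, hurwitzType_circleCoeff, hurwitzType_circleCoeff]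
    split_ifs
    · rw [key f h.left, sub_add_eq_add_sub]
    · rw [key g h.right, sub_add_eq_add_sub]
  · simp only [hurwitzType_circleCoeff]
    split_ifs
    · simpa only [sub_add_eq_add_sub] using
        hlim (fun z => f z * (1 - x * z⁻¹)⁻¹) (h.left.mul hc) (j - (i + 1) / 2)
    · simpa only [sub_add_eq_add_sub] using
        hlim (fun z => g z * (1 - x * z⁻¹)⁻¹) (h.right.mul hc) (j - i / 2)

end IsMultiplier

/-! ### The Euclidean algorithm for interlacing zeros -/

theorem neg_one_pow_mul_prod_sub_pos {a : ℕ → ℝ} {x : ℝ} {n N : ℕ} (hn : n ≤ N)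
    (h₁ : ∀ i < n, a i < x) (h₂ : ∀ i, n ≤ i → i < N → x < a i) :
    0 < (-1) ^ n * ∏ i ∈ Finset.range N, (a i - x) := by
  rw [← Finset.prod_range_mul_prod_Ico _ hn, ← mul_assoc]
  refine mul_pos ?_ (Finset.prod_pos fun i hi => ?_)
  · have : (-1 : ℝ) ^ n = ∏ _i ∈ Finset.range n, (-1 : ℝ) := by simp
    rw [this, ← Finset.prod_mul_distrib]
    refine Finset.prod_pos fun i hi => ?_
    have := h₁ i (Finset.mem_range.1 hi)
    linarith
  · rw [Finset.mem_Ico] at hi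
    have := h₂ i hi.1 hi.2
    linarith

/-- The difference of the two sides has degree below `m`, since the coefficients of degree `m`
cancel, yet vanishes at `m` distinct points. -/
theorem Polynomial.eq_C_mul_prod_X_add_C {q : ℝ[X]} {m : ℕ} (hq : q.natDegree ≤ m) {e : ℕ → ℝ}
    (hinj : Set.InjOn e (Finset.range m)) (he : ∀ i < m, q.eval (-e i) = 0) :
    q = C (q.coeff m) * ∏ i ∈ Finset.range m, (X + C (e i)) := by
  have hmon : (∏ i ∈ Finset.range m, (X + C (e i))).Monic :=
    monic_prod_of_monic _ _ fun i _ => monic_X_add_C _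
  have hdeg : (∏ i ∈ Finset.range m, (X + C (e i))).natDegree = m := by
    rw [natDegree_prod_of_monic _ _ fun i _ => monic_X_add_C _]
    simp
  refine eq_of_degree_sub_lt_of_eval_index_eq (s := Finset.range m) (v := fun i => -e i)
    (fun i hi j hj hij => hinj hi hj (neg_injective hij)) ?_ fun i hi => ?_
  · rw [Finset.card_range, degree_lt_iff_coeff_zero]
    intro k hk
    rw [coeff_sub, coeff_C_mul]
    rcases hk.eq_or_lt with rfl | hlt
    · have h1 := hmon.coeff_natDegree
      rw [hdeg] at h1
      rw [h1]
      ring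
    · rw [coeff_eq_zero_of_natDegree_lt (hq.trans_lt hlt),
        coeff_eq_zero_of_natDegree_lt (hdeg.trans_lt hlt)]
      ring
  · rw [he i (Finset.mem_range.1 hi), eval_mul, eval_prod, Finset.prod_eq_zero hi, mul_zero]
    simp

/-- A double step of the Euclidean algorithm for polynomials with interlacing zeros. -/
theorem exists_interlacing_euclid {m : ℕ} {a b : ℕ → ℝ} (ha : 0 < a 0)
    (hab : ∀ i < m + 1, a i < b i ∧ b i < a (i + 1)) :
    ∃ (f c : ℝ) (e : ℕ → ℝ), 0 < f ∧ 0 < c ∧ (∀ i < m, b i < e i ∧ e i < b (i + 1)) ∧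
      ∏ i ∈ Finset.range (m + 2), (X + C (a i)) =
        C c * (X * ∏ i ∈ Finset.range m, (X + C (e i))) +
          C f * ∏ i ∈ Finset.range (m + 1), (X + C (b i)) +
          X * ∏ i ∈ Finset.range (m + 1), (X + C (b i)) := by
  have hmono : ∀ i j, i ≤ j → j ≤ m + 1 → a i ≤ a j := by
    intro i j hij
    induction j, hij using Nat.le_induction with
    | base => exact fun _ => le_rfl
    | succ j _ ih =>
      intro h
      exact (ih (by omega)).trans ((hab j (by omega)).1.trans (hab j (by omega)).2).le
  have hapos : ∀ i ≤ m + 1, 0 < a i := fun i hi => ha.trans_le (hmono 0 i (Nat.zero_le _) hi)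
  have hbpos : ∀ i < m + 1, 0 < b i := fun i hi => (hapos i hi.le).trans (hab i hi).1
  set P : ℝ[X] := ∏ i ∈ Finset.range (m + 2), (X + C (a i)) with hP
  set p : ℝ[X] := ∏ i ∈ Finset.range (m + 1), (X + C (b i)) with hp
  have hPm : P.Monic := monic_prod_of_monic _ _ fun i _ => monic_X_add_C _
  have hpm : p.Monic := monic_prod_of_monic _ _ fun i _ => monic_X_add_C _
  have hPd : P.natDegree = m + 2 := by
    rw [hP, natDegree_prod_of_monic _ _ fun i _ => monic_X_add_C _]
    simp
  have hpd : p.natDegree = m + 1 := by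
    rw [hp, natDegree_prod_of_monic _ _ fun i _ => monic_X_add_C _]
    simp
  have hPev : ∀ x, P.eval x = ∏ i ∈ Finset.range (m + 2), (x + a i) := fun x => by
    simp [hP, eval_prod]
  have hpev : ∀ x, p.eval x = ∏ i ∈ Finset.range (m + 1), (x + b i) := fun x => by
    simp [hp, eval_prod]
  have hP0 : 0 < P.eval 0 := by
    rw [hPev]
    refine Finset.prod_pos fun i hi => ?_
    rw [zero_add]
    exact hapos i (by simp at hi; omega)
  have hp0 : 0 < p.eval 0 := by
    rw [hpev]
    refine Finset.prod_pos fun i hi => ?_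
    rw [zero_add]
    exact hbpos i (by simpa using hi)
  -- This quotient makes the remainder vanish at 0, so that a factor X splits off.
  set f := P.eval 0 / p.eval 0 with hf
  set Q : ℝ[X] := P - C f * p - X * p with hQ
  have hQ0 : Q.coeff 0 = 0 := by
    rw [coeff_zero_eq_eval_zero, hQ]
    simp only [eval_sub, eval_mul, eval_C, eval_X]
    rw [hf, div_mul_cancel₀ _ hp0.ne']
    ring
  have hQd : Q.natDegree ≤ m + 1 := by
    rw [natDegree_le_iff_coeff_eq_zero]
    intro k hk
    obtain ⟨k, rfl⟩ : ∃ l, k = l + 1 := ⟨k - 1, by omega⟩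
    rw [hQ, coeff_sub, coeff_sub, coeff_C_mul, coeff_X_mul,
      coeff_eq_zero_of_natDegree_lt (p := p) (n := k + 1) (by omega)]
    rcases (show m + 1 ≤ k by omega).eq_or_lt with rfl | hlt
    · have h1 := hPm.coeff_natDegree
      have h2 := hpm.coeff_natDegree
      rw [hPd] at h1
      rw [hpd] at h2
      rw [h1, h2]
      ring
    · rw [coeff_eq_zero_of_natDegree_lt (p := P) (by omega),
        coeff_eq_zero_of_natDegree_lt (p := p) (by omega)]
      ring
  set q := Q.divX with hq
  have hQq : Q = X * q := by
    have := Q.divX_mul_X_add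
    rw [hQ0, C_0, add_zero] at this
    rw [← this, mul_comm]
  have hqd : q.natDegree ≤ m := by
    rw [hq, natDegree_divX_eq_natDegree_tsub_one]
    omega
  -- At a zero of `p` the remainder equals `P`, whose sign there is known from interlacing; dividing
  -- by the negative number `-b i` flips it.
  have hqb : ∀ i < m + 1, 0 < (-1) ^ i * q.eval (-b i) := by
    intro i hi
    have h1 : Q.eval (-b i) = P.eval (-b i) := by
      have : p.eval (-b i) = 0 := by
        rw [hpev]
        exact Finset.prod_eq_zero (Finset.mem_range.2 hi) (by ring)
      rw [hQ]
      simp [this]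
    have h2 : P.eval (-b i) = -b i * q.eval (-b i) := by
      rw [← h1, hQq]
      simp
    have h3 : 0 < (-1) ^ (i + 1) * P.eval (-b i) := by
      rw [hPev]
      have := neg_one_pow_mul_prod_sub_pos (a := a) (x := b i) (n := i + 1) (N := m + 2) (by omega)
        (fun j hj => (hmono j i (by omega) (by omega)).trans_lt (hab i hi).1)
        (fun j hj hjm => (hab i hi).2.trans_le (hmono (i + 1) j hj (by omega)))
      convert this using 3
      ring
    rw [h2] at h3
    have h4 : 0 < b i * ((-1) ^ i * q.eval (-b i)) := by
      rw [pow_succ] at h3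
      linarith
    exact pos_of_mul_pos_right h4 (hbpos i hi).le
  have hroot : ∀ i, ∃ x, i < m → (b i < x ∧ x < b (i + 1)) ∧ q.eval (-x) = 0 := by
    intro i
    by_cases hi : i < m
    · have hlt : b i < b (i + 1) :=
        (hab i (by omega)).2.trans (hab (i + 1) (by omega)).1
      have hcont : ContinuousOn (fun x => (-1) ^ i * q.eval (-x)) (Set.Icc (b i) (b (i + 1))) := by
        have := q.continuous
        fun_prop
      have h1 := hqb i (by omega)
      have h2 := hqb (i + 1) (by omega)
      rw [pow_succ] at h2
      obtain ⟨x, hx, hx0⟩ := intermediate_value_Ioo' hlt.le hcont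
        (show (0 : ℝ) ∈ Set.Ioo _ _ from ⟨by linarith, h1⟩)
      refine ⟨x, fun _ => ⟨hx, ?_⟩⟩
      exact (mul_eq_zero.1 hx0).resolve_left (pow_ne_zero _ (by norm_num))
    · exact ⟨0, fun h => absurd h hi⟩
  choose e he using hroot
  have hemono : ∀ i j, i < j → j < m → e i < e j := by
    intro i j hij hj
    have hb : ∀ k, i + 1 ≤ k → k ≤ m → b (i + 1) ≤ b k := by
      intro k hk
      induction k, hk using Nat.le_induction with
      | base => exact fun _ => le_rfl
      | succ k _ ih =>
        intro h
        exact (ih (by omega)).trans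
          ((hab k (by omega)).2.trans (hab (k + 1) (by omega)).1).le
    exact ((he i (by omega)).1.2.trans_le (hb j hij hj.le)).trans (he j hj).1.1
  have hinj : Set.InjOn e (Finset.range m) := by
    intro i hi j hj hij
    have hi' : i < m := by simpa using hi
    have hj' : j < m := by simpa using hj
    rcases lt_trichotomy i j with h | h | h
    · exact absurd hij (hemono i j h hj').ne
    · exact h
    · exact absurd hij (hemono j i h hi').ne'
  have hqe := eq_C_mul_prod_X_add_C hqd hinj fun i hi => (he i hi).2
  refine ⟨f, q.coeff m, e, div_pos hP0 hp0, ?_, fun i hi => (he i hi).1, ?_⟩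
  -- The leading coefficient has the sign of `q` at `-b 0`, a point to the right of all zeros of
  -- `q`.
  · have h1 := hqb 0 (by omega)
    rw [hqe, pow_zero, one_mul, eval_mul, eval_C, eval_prod] at h1
    refine pos_of_mul_pos_left h1 (Finset.prod_nonneg fun i hi => ?_)
    have hi' : i < m := by simpa using hi
    have hb : b 0 ≤ b i := by
      rcases Nat.eq_zero_or_pos i with rfl | h0
      · exact le_rfl
      · exact ((hab 0 (by omega)).2.trans_le
          ((hmono 1 i h0 (by omega)).trans (hab i (by omega)).1.le)).le
    have := (he i hi').1.1
    simp only [eval_add, eval_X, eval_C]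
    linarith
  · rw [mul_left_comm, ← hqe, ← hQq, hQ]
    ring

/-! ### Polynomial pairs with interlacing zeros -/

namespace HurwitzPair

variable {ρ : ℝ} {f g : ℂ → ℂ}

theorem prod_interlacing_zero (hρ : 0 < ρ) (m : ℕ) : ∀ {a b : ℕ → ℝ}, 0 < a 0 →
    (∀ i < m, a i < b i ∧ b i < a (i + 1)) →
    HurwitzPair ρ (fun z => ∏ i ∈ Finset.range (m + 1), (z + (a i : ℂ)))
      (fun z => z * ∏ i ∈ Finset.range m, (z + (b i : ℂ))) := by
  induction m with
  | zero =>
    intro a b ha _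
    refine ((((one_zero hρ).add_const_mul hρ ha.le).add_const_mul_id hρ zero_le_one).flip
      hρ).congr hρ (fun z _ => ?_) fun z _ => ?_
    · simp [add_comm]
    · simp
  | succ m ih =>
    intro a b ha hab
    obtain ⟨f, c, e, hf, hc, he, heq⟩ := exists_interlacing_euclid ha hab
    -- The induction hypothesis concerns the next pair of Euclid's algorithm, with zeros `b` and
    -- `e`. Scaling by `c`, adding `f` and z times the first function and flipping undoes one double
    -- step.
    have h0 : 0 < b 0 := ha.trans (hab 0 (Nat.succ_pos _)).1
    refine (((((ih h0 he).const_mul_right hc.le).add_const_mul hρ hf.le).add_const_mul_id hρ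
      zero_le_one).flip hρ).congr hρ (fun z _ => ?_) fun z _ => rfl
    have := congrArg (aeval z) heq
    simpa [map_prod] using this

/-- Used to discard an auxiliary zero after sending it to 0 or to infinity. -/
theorem of_tendsto_add_mul (hρ : 0 < ρ) {h : ℂ → ℂ} (hf : ContinuousOn f (sphere 0 ρ))
    (hh : ContinuousOn h (sphere 0 ρ)) {ε : ℕ → ℝ} (hε : Tendsto ε atTop (𝓝 0))
    (H : ∀ n, HurwitzPair ρ (fun z => f z + ε n * h z) g) : HurwitzPair ρ f g := by
  obtain ⟨A, hA⟩ := (isCompact_sphere (0 : ℂ) ρ).exists_bound_of_continuousOn hf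
  obtain ⟨B, hB⟩ := (isCompact_sphere (0 : ℂ) ρ).exists_bound_of_continuousOn hh
  obtain ⟨L, hL⟩ := (isCompact_sphere (0 : ℂ) ρ).exists_bound_of_continuousOn (H 0).right
  refine of_tendsto hρ (l := atTop) H hf (H 0).right (K := A + B) (L := L) ?_
    (Eventually.of_forall fun _ => hL) (fun z hz => ?_) fun z _ => tendsto_const_nhds
  · have : ∀ᶠ n in atTop, |ε n| < 1 := by
      have := hε.abs
      rw [abs_zero] at this
      exact this.eventually_lt_const zero_lt_one
    filter_upwards [this] with n hn z hz
    refine (norm_add_le _ _).trans (add_le_add (hA z hz) ?_)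
    rw [norm_mul, Complex.norm_real, Real.norm_eq_abs]
    exact (mul_le_of_le_one_left (norm_nonneg _) hn.le).trans (hB z hz)
  · have h1 : Tendsto (fun n => ((ε n : ℝ) : ℂ)) atTop (𝓝 ((0 : ℝ) : ℂ)) :=
      (Complex.continuous_ofReal.tendsto _).comp hε
    simpa using (h1.mul_const (h z)).const_add (f z)

theorem prod_range_interlacing (hρ : 0 < ρ) (n : ℕ) {a b : ℕ → ℝ} (h0 : 0 < n → 0 ≤ b 0)
    (hba : ∀ i < n, b i < a i) (hab : ∀ i, i + 1 < n → a i < b (i + 1)) :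
    HurwitzPair ρ (fun z => ∏ i ∈ Finset.range n, (z + (a i : ℂ)))
      (fun z => ∏ i ∈ Finset.range n, (z + (b i : ℂ))) := by
  rcases n with _ | m
  · refine ((one_zero hρ).add_const_mul hρ zero_le_one).congr hρ (fun z _ => ?_) fun z _ => ?_
    · simp
    · simp
  rcases (h0 (Nat.succ_pos _)).eq_or_lt with hb0 | hb0
  · have ha0 : 0 < a 0 := hb0.trans_lt (hba 0 (Nat.succ_pos _))
    refine (prod_interlacing_zero hρ m (b := fun i => b (i + 1)) ha0 fun i hi =>
      ⟨hab i (by omega), hba (i + 1) (by omega)⟩).congr hρ (fun z _ => rfl) fun z _ => ?_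
    simp only
    rw [Finset.prod_range_succ', ← hb0, mul_comm]
    simp
  · have hpos : ∀ n : ℕ, (0 : ℝ) < n + 2 := fun n => by positivity
    -- When `b 0 > 0`, an auxiliary zero at `-b 0 / (n + 2)` is prepended to the first polynomial.
    -- In the limit both functions carry a factor z, which is then divided out.
    have key : ∀ n : ℕ, HurwitzPair ρ (fun z => z * (∏ i ∈ Finset.range (m + 1), (z + (a i : ℂ))) +
        ((b 0 / (n + 2) : ℝ) : ℂ) * ∏ i ∈ Finset.range (m + 1), (z + (a i : ℂ)))
        (fun z => z * ∏ i ∈ Finset.range (m + 1), (z + (b i : ℂ))) := by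
      intro n
      refine (prod_interlacing_zero hρ (m + 1)
        (a := fun i => Nat.casesOn i (b 0 / (n + 2)) a) (b := b) (div_pos hb0 (hpos n))
        fun i hi => ?_).congr hρ (fun z _ => ?_) fun z _ => rfl
      · rcases i with _ | i
        · refine ⟨?_, hba 0 hi⟩
          change b 0 / (n + 2) < b 0
          rw [div_lt_iff₀ (hpos n)]
          nlinarith [(Nat.cast_nonneg n : (0 : ℝ) ≤ n)]
        · exact ⟨hab i hi, hba (i + 1) hi⟩
      · simp only
        rw [Finset.prod_range_succ' _ (m + 1), ← add_mul, mul_comm]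
        rfl
    have hlim : Tendsto (fun n : ℕ => b 0 / (n + 2)) atTop (𝓝 0) :=
      tendsto_const_nhds.div_atTop
        (tendsto_atTop_add_const_right _ _ tendsto_natCast_atTop_atTop)
    have := (IsMultiplier.zpow hρ (-1)).mul _ _ (of_tendsto_add_mul hρ (by fun_prop)
      (by fun_prop) hlim key)
    refine this.congr hρ (fun z hz => ?_) fun z hz => ?_ <;>
    · have hz0 := ne_zero_of_mem_sphere_zero hρ hz
      simp only [zpow_neg_one]
      field_simp

theorem prod_interlacing (hρ : 0 < ρ) {K : Finset ℤ} {a b : ℤ → ℝ} (h0 : ∀ k ∈ K, 0 ≤ b k)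
    (hba : ∀ k ∈ K, b k < a k) (hab : ∀ k ∈ K, ∀ l ∈ K, k < l → a k < b l) :
    HurwitzPair ρ (fun z => ∏ k ∈ K, (z + (a k : ℂ))) (fun z => ∏ k ∈ K, (z + (b k : ℂ))) := by
  set φ := K.orderEmbOfFin rfl with hφ
  have hmem : ∀ i, φ i ∈ K := fun i => K.orderEmbOfFin_mem rfl i
  have hprod : ∀ (c : ℤ → ℝ) (z : ℂ), ∏ i ∈ Finset.range K.card,
      (z + ((if h : i < K.card then c (φ ⟨i, h⟩) else 0 : ℝ) : ℂ)) = ∏ k ∈ K, (z + (c k : ℂ)) := by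
    intro c z
    rw [Finset.prod_range]
    have h1 : ∏ k ∈ K, (z + (c k : ℂ)) = ∏ k ∈ Finset.univ.map φ.toEmbedding, (z + (c k : ℂ)) := by
      rw [hφ, K.map_orderEmbOfFin_univ rfl]
    rw [h1, Finset.prod_map]
    exact Finset.prod_congr rfl fun i _ => by simp
  refine (prod_range_interlacing hρ K.card
    (a := fun i => if h : i < K.card then a (φ ⟨i, h⟩) else 0)
    (b := fun i => if h : i < K.card then b (φ ⟨i, h⟩) else 0)
    (fun h => ?_) (fun i hi => ?_) fun i hi => ?_).congr hρ
    (fun z _ => (hprod a z).symm) fun z _ => (hprod b z).symm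
  · simp only [dif_pos h]
    exact h0 _ (hmem _)
  · simp only [dif_pos hi]
    exact hba _ (hmem _)
  · have hi' : i < K.card := by omega
    simp only [dif_pos hi, dif_pos hi']
    exact hab _ (hmem _) _ (hmem _) (φ.strictMono (by simp))

/-- Interlacing zeros, the last of which need not belong to the first function: its index is then
missing from `N`. -/
theorem prod_interlacing_filter (hρ : 0 < ρ) {K : Finset ℤ} {N : Set ℤ} [DecidablePred (· ∈ N)]
    {a b : ℤ → ℝ} (h0 : ∀ k ∈ K, 0 ≤ b k) (hba : ∀ k ∈ K, k ∈ N → b k < a k)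
    (hab : ∀ k ∈ K, ∀ l ∈ K, k < l → k ∈ N ∧ a k < b l) :
    HurwitzPair ρ (fun z => ∏ k ∈ K with k ∈ N, (z + (a k : ℂ)))
      (fun z => ∏ k ∈ K, (z + (b k : ℂ))) := by
  by_cases hN : ∀ k ∈ K, k ∈ N
  · rw [Finset.filter_true_of_mem hN]
    exact prod_interlacing hρ h0 (fun k hk => hba k hk (hN k hk))
      fun k hk l hl hkl => (hab k hk l hl hkl).2
  push Not at hN
  obtain ⟨k₀, hk₀, hk₀N⟩ := hN
  have hmax : ∀ k ∈ K, k ≤ k₀ := fun k hk =>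
    not_lt.1 fun h => hk₀N (hab k₀ hk₀ k hk h).1
  have hfil : K.filter (· ∈ N) = K.erase k₀ := by
    ext k
    simp only [Finset.mem_filter, Finset.mem_erase]
    refine ⟨fun h => ⟨fun e => hk₀N (e ▸ h.2), h.1⟩, fun h => ⟨h.2, ?_⟩⟩
    exact (hab k h.2 k₀ hk₀ ((hmax k h.2).lt_of_ne h.1)).1
  rw [hfil]
  have hpos : ∀ n : ℕ, 0 < b k₀ + 1 + n := fun n => by
    have := h0 k₀ hk₀
    positivity
  -- The missing partner of the last zero is supplied at the distance A = b k₀ + 1 + n from the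
  -- origin. Dividing the first polynomial by A turns the extra factor into 1 + z/A, which tends to
  -- 1.
  have key : ∀ n : ℕ, HurwitzPair ρ (fun z => ∏ k ∈ K.erase k₀, (z + (a k : ℂ)) +
      ((1 / (b k₀ + 1 + n) : ℝ) : ℂ) * (z * ∏ k ∈ K.erase k₀, (z + (a k : ℂ))))
      (fun z => ∏ k ∈ K, (z + (b k : ℂ))) := by
    intro n
    have h1 := prod_interlacing hρ (K := K) (a := Function.update a k₀ (b k₀ + 1 + n)) (b := b) h0
      (fun k hk => by
        rcases eq_or_ne k k₀ with rfl | hne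
        · rw [Function.update_self]
          linarith [(Nat.cast_nonneg n : (0 : ℝ) ≤ n)]
        · rw [Function.update_of_ne hne]
          exact hba k hk (hab k hk k₀ hk₀ ((hmax k hk).lt_of_ne hne)).1)
      (fun k hk l hl hkl => by
        rw [Function.update_of_ne (hkl.trans_le (hmax l hl)).ne]
        exact (hab k hk l hl hkl).2)
    refine (((IsMultiplier.const (ρ := ρ) (one_div_pos.2 (hpos n)).le).mul _ _ h1).const_mul_right
      (hpos n).le).congr hρ (fun z _ => ?_) fun z _ => ?_
    · simp only
      rw [← Finset.mul_prod_erase K _ hk₀, Function.update_self]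
      have h2 : ∏ k ∈ K.erase k₀, (z + ((Function.update a k₀ (b k₀ + 1 + n) k : ℝ) : ℂ)) =
          ∏ k ∈ K.erase k₀, (z + (a k : ℂ)) :=
        Finset.prod_congr rfl fun k hk => by
          rw [Function.update_of_ne (Finset.ne_of_mem_erase hk)]
      rw [h2]
      have h3 : ((b k₀ + 1 + n : ℝ) : ℂ) ≠ 0 := Complex.ofReal_ne_zero.2 (hpos n).ne'
      rw [one_div, Complex.ofReal_inv]
      field_simp
      ring
    · have h3 : ((b k₀ + 1 + n : ℝ) : ℂ) ≠ 0 := Complex.ofReal_ne_zero.2 (hpos n).ne'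
      simp only
      rw [one_div, Complex.ofReal_inv]
      field_simp
  refine of_tendsto_add_mul hρ (by fun_prop) (by fun_prop) ?_ key
  exact tendsto_const_nhds.div_atTop
    (tendsto_atTop_add_const_left _ _ tendsto_natCast_atTop_atTop)

end HurwitzPair

/-! ### Canonical products of genus zero -/

/-- The canonical product `∏ (1 + x_k z)`. -/
noncomputable def linProd (x : ℤ → ℝ) (z : ℂ) : ℂ := ∏' k, (1 + (x k : ℂ) * z)

section linProd

variable {x : ℤ → ℝ}

theorem summable_norm_ofReal_mul (hx : Summable x) (z : ℂ) :
    Summable fun k => ‖(x k : ℂ) * z‖ := by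
  simpa using hx.abs.mul_right ‖z‖

theorem linProd_tendsto (hx : Summable x) (z : ℂ) :
    Tendsto (fun s : Finset ℤ => ∏ k ∈ s, (1 + (x k : ℂ) * z)) atTop (𝓝 (linProd x z)) :=
  (multipliable_one_add_of_summable (summable_norm_ofReal_mul hx z)).hasProd

theorem linProd_ne_zero (hx : Summable x) {z : ℂ} (h : ∀ k, 1 + (x k : ℂ) * z ≠ 0) :
    linProd x z ≠ 0 :=
  tprod_one_add_ne_zero_of_summable h (summable_norm_ofReal_mul hx z)

theorem summable_update_zero (hx : Summable x) (k : ℤ) : Summable (Function.update x k 0) :=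
  hx.update k 0

theorem linProd_eq_mul_update (hx : Summable x) (k : ℤ) (z : ℂ) :
    linProd x z = (1 + (x k : ℂ) * z) * linProd (Function.update x k 0) z := by
  have h1 : (fun l => 1 + ((Function.update x k 0 l : ℝ) : ℂ) * z) =
      Function.update (fun l => 1 + (x l : ℂ) * z) k 1 := by
    funext l
    rcases eq_or_ne l k with rfl | h
    · simp
    · simp [h]
  have h2 : Multipliable (Function.update (fun l => 1 + (x l : ℂ) * z) k 1) := by
    rw [← h1]
    exact multipliable_one_add_of_summable
      (summable_norm_ofReal_mul (summable_update_zero hx k) z)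
  unfold linProd
  rw [h1, Multipliable.tprod_eq_mul_tprod_ite' k h2]
  congr 2
  funext l
  simp [Function.update_apply]

theorem linProd_eq_zero (hx : Summable x) {z : ℂ} {k : ℤ} (h : 1 + (x k : ℂ) * z = 0) :
    linProd x z = 0 := by
  rw [linProd_eq_mul_update hx k, h, zero_mul]

theorem linProd_differentiable (hx : Summable x) : Differentiable ℂ (linProd x) := by
  intro z
  have hd : DifferentiableOn ℂ (linProd x) (ball 0 (‖z‖ + 1)) := by
    have h1 := Summable.hasProdLocallyUniformlyOn_one_add (f := fun k z => (x k : ℂ) * z)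
      (isOpen_ball (x := (0 : ℂ)) (ε := ‖z‖ + 1)) (hx.abs.mul_right (‖z‖ + 1))
      (Eventually.of_forall fun k w hw => by
        rw [norm_mul, Complex.norm_real, Real.norm_eq_abs]
        exact mul_le_mul_of_nonneg_left (mem_ball_zero_iff.1 hw).le (abs_nonneg _))
      (fun k => by fun_prop)
    rw [hasProdLocallyUniformlyOn_iff_tendstoLocallyUniformlyOn] at h1
    exact h1.differentiableOn (Eventually.of_forall fun s => by fun_prop) isOpen_ball
  exact hd.differentiableAt (isOpen_ball.mem_nhds (by simp))

theorem norm_prod_one_add_mul_le (hx : Summable x) (s : Finset ℤ) (z : ℂ) :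
    ‖∏ k ∈ s, (1 + (x k : ℂ) * z)‖ ≤ Real.exp ((∑' k, |x k|) * ‖z‖) := by
  rw [norm_prod]
  refine (Finset.prod_le_prod (fun _ _ => norm_nonneg _) fun k _ => ?_).trans
    ((Real.prod_one_add_le_exp_sum s (f := fun k => |x k| * ‖z‖) fun k => by positivity).trans ?_)
  · refine (norm_add_le _ _).trans ?_
    simp
  · rw [Real.exp_le_exp, ← Finset.sum_mul]
    exact mul_le_mul_of_nonneg_right (hx.abs.sum_le_tsum _ fun _ _ => abs_nonneg _) (norm_nonneg _)

/-- On |z| = r each factor has modulus at least |1 - |x_k| r|, and the product of these numbers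
converges to a nonzero limit because none of them vanishes. -/
theorem exists_norm_inv_prod_one_add_mul_le (hx : Summable x) {r : ℝ}
    (h : ∀ k, |x k| * r ≠ 1) : ∃ K : ℝ, ∀ᶠ s : Finset ℤ in atTop, ∀ z : ℂ, ‖z‖ = r →
      ‖(∏ k ∈ s, (1 + (x k : ℂ) * z))⁻¹‖ ≤ K := by
  have hx' : Summable fun k => -|x k| := hx.abs.neg
  have hne : linProd (fun k => -|x k|) r ≠ 0 := linProd_ne_zero hx' fun k => by
    rw [← Complex.ofReal_mul, ← Complex.ofReal_one, ← Complex.ofReal_add, Complex.ofReal_ne_zero]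
    intro h0
    exact h k (by linarith)
  have hlim := ((linProd_tendsto hx' r).inv₀ hne).norm
  refine ⟨_, (hlim.eventually_le_const (lt_add_one _)).mono fun s hs z hz => le_trans ?_ hs⟩
  rw [norm_inv, norm_inv, norm_prod, norm_prod]
  have hfac : ∀ k, ‖1 + ((-|x k| : ℝ) : ℂ) * r‖ = |1 - |x k| * r| := fun k => by
    rw [← Complex.ofReal_mul, ← Complex.ofReal_one, ← Complex.ofReal_add, Complex.norm_real,
      Real.norm_eq_abs]
    congr 1
    ring
  have hpos : ∀ k, 0 < |1 - |x k| * r| := fun k => abs_pos.2 fun h0 => h k (by linarith)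
  refine inv_anti₀ (Finset.prod_pos fun k _ => by rw [hfac]; exact hpos k)
    (Finset.prod_le_prod (fun _ _ => norm_nonneg _) fun k _ => ?_)
  rw [hfac]
  have h1 := abs_norm_sub_norm_le (1 : ℂ) (-((x k : ℂ) * z))
  rw [sub_neg_eq_add, norm_neg, norm_mul, hz] at h1
  simpa using h1

end linProd

theorem norm_inv_eq_of_mem_sphere {ρ : ℝ} {z : ℂ} (hz : z ∈ sphere (0 : ℂ) ρ) : ‖z⁻¹‖ = ρ⁻¹ := by
  rw [norm_inv, mem_sphere_zero_iff_norm.1 hz]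

theorem continuousOn_inv_sphere {ρ : ℝ} (hρ : 0 < ρ) :
    ContinuousOn (fun z : ℂ => z⁻¹) (sphere 0 ρ) :=
  continuousOn_inv₀.mono fun _ hz => ne_zero_of_mem_sphere_zero hρ hz

/-! ### Multipliers: infinite products and exponentials -/

namespace IsMultiplier

variable {ρ : ℝ}

theorem linProd (hρ : 0 < ρ) {x : ℤ → ℝ} (hx : Summable x) (h0 : ∀ k, 0 ≤ x k) :
    IsMultiplier ρ (linProd x) := by
  refine of_tendsto hρ (fun s : Finset ℤ => prod fun k _ => one_add_mul hρ (h0 k))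
    (linProd_differentiable hx).continuous.continuousOn
    (K := Real.exp ((∑' k, |x k|) * ρ)) (Eventually.of_forall fun s z hz => ?_)
    fun z _ => linProd_tendsto hx z
  · simpa [mem_sphere_zero_iff_norm.1 hz] using norm_prod_one_add_mul_le hx s z

theorem linProd_inv (hρ : 0 < ρ) {x : ℤ → ℝ} (hx : Summable x) (h0 : ∀ k, 0 ≤ x k) :
    IsMultiplier ρ fun z => _root_.linProd x z⁻¹ := by
  refine of_tendsto hρ (fun s : Finset ℤ => prod fun k _ => one_add_mul_inv hρ (h0 k))
    ((linProd_differentiable hx).continuous.comp_continuousOn (continuousOn_inv_sphere hρ))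
    (K := Real.exp ((∑' k, |x k|) * ρ⁻¹)) (Eventually.of_forall fun s z hz => ?_)
    fun z _ => linProd_tendsto hx z⁻¹
  · simpa [mem_sphere_zero_iff_norm.1 hz] using norm_prod_one_add_mul_le hx s z⁻¹

theorem one_add_neg_ne_zero {u : ℝ} (hu : 0 ≤ u) {z : ℂ} (h : u * ‖z‖ < 1) :
    1 + ((-u : ℝ) : ℂ) * z ≠ 0 := by
  rw [Complex.ofReal_neg, neg_mul, ← sub_eq_add_neg]
  refine one_sub_ne_zero ?_
  rwa [norm_mul, Complex.norm_real, Real.norm_of_nonneg hu]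

theorem inv_linProd_neg (hρ : 0 < ρ) {u : ℤ → ℝ} (hu : Summable u) (h0 : ∀ k, 0 ≤ u k)
    (h1 : ∀ k, u k * ρ < 1) : IsMultiplier ρ fun z => (_root_.linProd (fun k => -u k) z)⁻¹ := by
  have hne : ∀ z ∈ sphere (0 : ℂ) ρ, _root_.linProd (fun k => -u k) z ≠ 0 := fun z hz =>
    linProd_ne_zero hu.neg fun k => one_add_neg_ne_zero (h0 k) (by
      rw [mem_sphere_zero_iff_norm.1 hz]
      exact h1 k)
  obtain ⟨K, hK⟩ := exists_norm_inv_prod_one_add_mul_le (x := fun k => -u k) hu.neg (r := ρ)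
    fun k => by
      rw [abs_neg, abs_of_nonneg (h0 k)]
      exact (h1 k).ne
  refine of_tendsto hρ (l := atTop) (F := fun (s : Finset ℤ) z => ∏ k ∈ s, (1 - (u k : ℂ) * z)⁻¹)
    (fun s : Finset ℤ => prod fun k _ => inv_one_sub_mul hρ (h0 k) (h1 k))
    ((linProd_differentiable hu.neg).continuous.continuousOn.inv₀ hne) (K := K)
    (hK.mono fun s hs z hz => ?_) fun z hz => ?_
  · simpa [sub_eq_add_neg] using hs z (mem_sphere_zero_iff_norm.1 hz)
  · simpa [sub_eq_add_neg] using (linProd_tendsto hu.neg z).inv₀ (hne z hz)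

theorem inv_linProd_neg_inv (hρ : 0 < ρ) {u : ℤ → ℝ} (hu : Summable u) (h0 : ∀ k, 0 ≤ u k)
    (h1 : ∀ k, u k < ρ) : IsMultiplier ρ fun z => (_root_.linProd (fun k => -u k) z⁻¹)⁻¹ := by
  have h1' : ∀ k, u k * ρ⁻¹ < 1 := fun k => by
    rw [← div_eq_mul_inv, div_lt_one hρ]
    exact h1 k
  have hne : ∀ z ∈ sphere (0 : ℂ) ρ, _root_.linProd (fun k => -u k) z⁻¹ ≠ 0 := fun z hz =>
    linProd_ne_zero hu.neg fun k => one_add_neg_ne_zero (h0 k) (by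
      rw [norm_inv_eq_of_mem_sphere hz]
      exact h1' k)
  obtain ⟨K, hK⟩ := exists_norm_inv_prod_one_add_mul_le (x := fun k => -u k) hu.neg
    (r := ρ⁻¹) fun k => by
      rw [abs_neg, abs_of_nonneg (h0 k)]
      exact (h1' k).ne
  refine of_tendsto hρ (l := atTop)
    (F := fun (s : Finset ℤ) z => ∏ k ∈ s, (1 - (u k : ℂ) * z⁻¹)⁻¹)
    (fun s : Finset ℤ => prod fun k _ => inv_one_sub_mul_inv hρ (h0 k) (h1 k))
    (((linProd_differentiable hu.neg).continuous.comp_continuousOn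
      (continuousOn_inv_sphere hρ)).inv₀ hne) (K := K)
    (hK.mono fun s hs z hz => ?_) fun z hz => ?_
  · simpa [sub_eq_add_neg] using hs z⁻¹ (norm_inv_eq_of_mem_sphere hz)
  · simpa [sub_eq_add_neg] using (linProd_tendsto hu.neg z⁻¹).inv₀ (hne z hz)

theorem norm_one_add_div_pow_le (w : ℂ) (n : ℕ) : ‖(1 + w / n) ^ n‖ ≤ Real.exp ‖w‖ := by
  rcases Nat.eq_zero_or_pos n with rfl | hn
  · simp
  rw [norm_pow]
  have h1 : ‖1 + w / n‖ ≤ Real.exp (‖w‖ / n) := by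
    refine (norm_add_le _ _).trans ?_
    rw [norm_one, norm_div, Complex.norm_natCast, add_comm]
    exact Real.add_one_le_exp _
  refine (pow_le_pow_left₀ (norm_nonneg _) h1 n).trans_eq ?_
  rw [← Real.exp_nat_mul]
  congr 1
  field_simp

/-- The exponential is the limit of (1 + Az/n)^n, a power of an elementary multiplier. -/
theorem exp_mul (hρ : 0 < ρ) {A : ℝ} (hA : 0 ≤ A) :
    IsMultiplier ρ fun z => Complex.exp (A * z) := by
  refine of_tendsto hρ (l := atTop) (F := fun (n : ℕ) z => (1 + ((A / n : ℝ) : ℂ) * z) ^ n)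
    (fun n => (one_add_mul hρ (by positivity)).pow n) (by fun_prop) (K := Real.exp (A * ρ))
    (Eventually.of_forall fun n z hz => ?_) fun z _ => ?_
  · have := norm_one_add_div_pow_le ((A : ℂ) * z) n
    rw [norm_mul, Complex.norm_real, Real.norm_of_nonneg hA, mem_sphere_zero_iff_norm.1 hz] at this
    convert this using 4
    push_cast
    ring
  · refine (Complex.tendsto_one_add_div_pow_exp ((A : ℂ) * z)).congr fun n => ?_
    push_cast
    ring

theorem exp_mul_inv (hρ : 0 < ρ) {A : ℝ} (hA : 0 ≤ A) :
    IsMultiplier ρ fun z => Complex.exp (A * z⁻¹) := by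
  refine of_tendsto hρ (l := atTop) (F := fun (n : ℕ) z => (1 + ((A / n : ℝ) : ℂ) * z⁻¹) ^ n)
    (fun n => (one_add_mul_inv hρ (by positivity)).pow n)
    (Complex.continuous_exp.comp_continuousOn
      (continuousOn_const.mul (continuousOn_inv_sphere hρ))) (K := Real.exp (A * ρ⁻¹))
    (Eventually.of_forall fun n z hz => ?_) fun z _ => ?_
  · have := norm_one_add_div_pow_le ((A : ℂ) * z⁻¹) n
    rw [norm_mul, Complex.norm_real, Real.norm_of_nonneg hA, norm_inv_eq_of_mem_sphere hz] at this
    convert this using 4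
    push_cast
    ring
  · refine (Complex.tendsto_one_add_div_pow_exp ((A : ℂ) * z⁻¹)).congr fun n => ?_
    push_cast
    ring

end IsMultiplier

/-! ### Splitting zeros off canonical products -/

/-- `f` is of the form `C z^j ∏ (1 + x_k z) ∏ (1 + y_k / z)` with nonnegative parameters. -/
def IsCanonicalProd (f : ℂ → ℂ) : Prop :=
  ∃ (C : ℝ) (j : ℤ) (x y : ℤ → ℝ), 0 < C ∧ Summable x ∧ Summable y ∧ (∀ k, 0 ≤ x k) ∧
    (∀ k, 0 ≤ y k) ∧ ∀ z, z ≠ 0 → f z = C * z ^ j * linProd x z * linProd y z⁻¹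

namespace IsCanonicalProd

variable {f : ℂ → ℂ} {ρ : ℝ}

theorem isMultiplier (hρ : 0 < ρ) (hf : IsCanonicalProd f) : IsMultiplier ρ f := by
  obtain ⟨C, j, x, y, hC, hx, hy, hx0, hy0, hfz⟩ := hf
  exact ((((IsMultiplier.const hC.le).mul' (IsMultiplier.zpow hρ j)).mul'
    (IsMultiplier.linProd hρ hx hx0)).mul' (IsMultiplier.linProd_inv hρ hy hy0)).congr hρ
    fun z hz => hfz z (ne_zero_of_mem_sphere_zero hρ hz)

/-- A convergent product vanishes only through one of its factors. Setting that parameter to 0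
removes the factor and leaves a function of the same type, hence still a multiplier. -/
theorem exists_eq_mul (hf : IsCanonicalProd f) {a : ℝ} (ha : 0 < a) (h0 : f (-a) = 0) :
    ∃ g, IsCanonicalProd g ∧ ∀ z, z ≠ 0 → f z = (z + a) * g z := by
  obtain ⟨C, j, x, y, hC, hx, hy, hx0, hy0, hfz⟩ := hf
  have haC : (a : ℂ) ≠ 0 := Complex.ofReal_ne_zero.2 ha.ne'
  have hCC : (C : ℂ) ≠ 0 := Complex.ofReal_ne_zero.2 hC.ne'
  have hupd : ∀ (u : ℤ → ℝ) (k : ℤ), (∀ l, 0 ≤ u l) → ∀ l, 0 ≤ Function.update u k 0 l := by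
    intro u k hu l
    rw [Function.update_apply]
    split_ifs
    exacts [le_rfl, hu l]
  have hna : (-(a : ℂ)) ≠ 0 := neg_ne_zero.2 haC
  rw [hfz _ hna] at h0
  rcases mul_eq_zero.1 h0 with h1 | h1
  · have h2 := (mul_eq_zero.1 h1).resolve_left (mul_ne_zero hCC (zpow_ne_zero _ hna))
    obtain ⟨k, hk⟩ : ∃ k, 1 + (x k : ℂ) * (-a) = 0 := by
      by_contra! h
      exact linProd_ne_zero hx h h2
    refine ⟨fun z => ((C / a : ℝ) : ℂ) * z ^ j * linProd (Function.update x k 0) z *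
      linProd y z⁻¹, ⟨C / a, j, Function.update x k 0, y, div_pos hC ha, summable_update_zero hx k,
      hy, hupd x k hx0, hy0, fun _ _ => rfl⟩, fun z hz => ?_⟩
    rw [hfz z hz, linProd_eq_mul_update hx k]
    have hxk : (x k : ℂ) = (a : ℂ)⁻¹ := by
      field_simp
      linear_combination -hk
    rw [hxk]
    push_cast
    field_simp
    ring
  · obtain ⟨k, hk⟩ : ∃ k, 1 + (y k : ℂ) * (-a : ℂ)⁻¹ = 0 := by
      by_contra! h
      exact linProd_ne_zero hy h h1
    -- Here the factor is 1 + a/z = z⁻¹(z + a), which lowers the exponent `j` by one.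
    refine ⟨fun z => (C : ℂ) * z ^ (j - 1) * linProd x z *
      linProd (Function.update y k 0) z⁻¹, ⟨C, j - 1, x, Function.update y k 0, hC, hx,
      summable_update_zero hy k, hx0, hupd y k hy0, fun _ _ => rfl⟩, fun z hz => ?_⟩
    rw [hfz z hz, linProd_eq_mul_update hy k]
    have hyk : (y k : ℂ) = a := by
      field_simp at hk
      linear_combination -hk
    simp only
    rw [hyk, zpow_sub_one₀ hz]
    field_simp

theorem exists_eq_prod_mul (hf : IsCanonicalProd f) {S : Finset ℝ} (hpos : ∀ a ∈ S, 0 < a)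
    (h0 : ∀ a ∈ S, f (-(a : ℂ)) = 0) :
    ∃ g, IsCanonicalProd g ∧ ∀ z, z ≠ 0 → f z = (∏ a ∈ S, (z + (a : ℂ))) * g z := by
  induction S using Finset.induction_on with
  | empty => exact ⟨f, hf, fun z _ => by simp⟩
  | insert a S ha ih =>
    obtain ⟨g, hg, hfg⟩ := ih (fun b hb => hpos b (Finset.mem_insert_of_mem hb))
      fun b hb => h0 b (Finset.mem_insert_of_mem hb)
    have hap := hpos a (Finset.mem_insert_self _ _)
    have hga : g (-a) = 0 := by
      have h1 := h0 a (Finset.mem_insert_self _ _)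
      rw [hfg _ (neg_ne_zero.2 (Complex.ofReal_ne_zero.2 hap.ne'))] at h1
      refine (mul_eq_zero.1 h1).resolve_left (Finset.prod_ne_zero_iff.2 fun b hb hab => ?_)
      have : b = a := by
        rw [neg_add_eq_zero] at hab
        exact (Complex.ofReal_injective hab).symm
      exact ha (this ▸ hb)
    obtain ⟨g', hg', hgg⟩ := hg.exists_eq_mul hap hga
    refine ⟨g', hg', fun z hz => ?_⟩
    rw [Finset.prod_insert ha, hfg z hz, hgg z hz]
    ring

end IsCanonicalProd

/-! ### Pairs whose ratio is an interlacing product -/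

/-- The zeros `-b_k` (`k ∈ K`) and the poles `-a_k` (`k ∈ K ∩ N`) interlace, the last zero not
necessarily being followed by a pole. -/
structure InterlacingParams (K N : Set ℤ) (a b : ℤ → ℝ) : Prop where
  nonneg : ∀ k ∈ K, 0 ≤ b k
  lt : ∀ k ∈ K, k ∈ N → b k < a k
  lt_next : ∀ k ∈ K, ∀ l ∈ K, k < l → k ∈ N ∧ a k < b l

namespace InterlacingParams

variable {K N : Set ℤ} {a b : ℤ → ℝ}

theorem pos (h : InterlacingParams K N a b) {k : ℤ} (hk : k ∈ K) (hkN : k ∈ N) : 0 < a k :=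
  (h.nonneg k hk).trans_lt (h.lt k hk hkN)

theorem strictMonoOn (h : InterlacingParams K N a b) : StrictMonoOn a (K ∩ N) :=
  fun k hk l hl hkl => (h.lt_next k hk.1 l hl.1 hkl).2.trans (h.lt l hl.1 hl.2)

theorem ne (h : InterlacingParams K N a b) {k l : ℤ} (hk : k ∈ K) (hkN : k ∈ N) (hl : l ∈ K) :
    b l ≠ a k := by
  rcases lt_trichotomy k l with hkl | rfl | hkl
  · exact (h.lt_next k hk l hl hkl).2.ne'
  · exact (h.lt k hk hkN).ne
  · have h1 := h.lt_next l hl k hk hkl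
    exact ((h.lt l hl h1.1).trans (h1.2.trans (h.lt k hk hkN))).ne

-- The denominator of the finite product divides `f`. Cancelling it exhibits the pair as two
-- interlacing polynomials times the common multiplier formed by the cofactor and `W`.
open Classical in
theorem hurwitzPair_finite (h : InterlacingParams K N a b) {ρ : ℝ} (hρ : 0 < ρ) {f W : ℂ → ℂ}
    (hf : IsCanonicalProd f) (hW : IsMultiplier ρ W)
    (h0 : ∀ k ∈ K, k ∈ N → f (-(a k : ℂ)) = 0) (hne : ∀ k ∈ K, k ∈ N → a k ≠ ρ) (s : Finset ℤ) :
    HurwitzPair ρ (fun z => f z * W z) fun z => f z * W z *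
      ∏ k ∈ s, ((if k ∈ K then z + (b k : ℂ) else 1) /
        if k ∈ K ∧ k ∈ N then z + (a k : ℂ) else 1) := by
  set T := (s.filter (· ∈ K)).filter (· ∈ N) with hT
  have hTm : ∀ k ∈ T, k ∈ K ∧ k ∈ N := fun k hk => by
    simp only [hT, Finset.mem_filter] at hk
    exact ⟨hk.1.2, hk.2⟩
  have hinj : Set.InjOn a T := h.strictMonoOn.injOn.mono fun k hk => hTm k hk
  obtain ⟨g, hg, hfg⟩ := hf.exists_eq_prod_mul (S := T.image a)
    (fun c hc => by
      obtain ⟨k, hk, rfl⟩ := Finset.mem_image.1 hc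
      exact h.pos (hTm k hk).1 (hTm k hk).2)
    (fun c hc => by
      obtain ⟨k, hk, rfl⟩ := Finset.mem_image.1 hc
      exact h0 k (hTm k hk).1 (hTm k hk).2)
  have hpair := HurwitzPair.prod_interlacing_filter hρ (K := s.filter (· ∈ K)) (N := N) (a := a)
    (b := b) (fun k hk => h.nonneg k (Finset.mem_filter.1 hk).2)
    (fun k hk => h.lt k (Finset.mem_filter.1 hk).2)
    (fun k hk l hl => h.lt_next k (Finset.mem_filter.1 hk).2 l (Finset.mem_filter.1 hl).2)
  refine (((hg.isMultiplier hρ).mul' hW).mul _ _ hpair).congr hρ (fun z hz => ?_) fun z hz => ?_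
  · simp only
    rw [hfg z (ne_zero_of_mem_sphere_zero hρ hz), Finset.prod_image hinj]
    ring
  · simp only
    have hz0 : ∏ k ∈ T, (z + (a k : ℂ)) ≠ 0 := by
      refine Finset.prod_ne_zero_iff.2 fun k hk hk0 => hne k (hTm k hk).1 (hTm k hk).2 ?_
      have h1 := mem_sphere_zero_iff_norm.1 hz
      rw [eq_neg_of_add_eq_zero_left hk0, norm_neg, Complex.norm_real,
        Real.norm_of_nonneg (h.pos (hTm k hk).1 (hTm k hk).2).le] at h1
      exact h1
    have e : T = s.filter (fun k => k ∈ K ∧ k ∈ N) := by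
      rw [hT, Finset.filter_filter]
    rw [hfg z (ne_zero_of_mem_sphere_zero hρ hz), Finset.prod_image hinj, Finset.prod_div_distrib,
      ← Finset.prod_filter, ← Finset.prod_filter, ← e]
    field_simp

open Classical in
theorem hurwitzPair (h : InterlacingParams K N a b) {ρ : ℝ} (hρ : 0 < ρ) {f W : ℂ → ℂ}
    (hf : IsCanonicalProd f) (hW : IsMultiplier ρ W)
    (h0 : ∀ k ∈ K, k ∈ N → f (-(a k : ℂ)) = 0) (hne : ∀ k ∈ K, k ∈ N → a k ≠ ρ)
    {R : Finset ℤ → ℂ → ℂ} {F : ℂ → ℂ} (hF : ContinuousOn F (sphere 0 ρ))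
    (hR : ∀ s, ∃ c : ℝ, 0 ≤ c ∧ ∃ s' : Finset ℤ, ∀ z ∈ sphere (0 : ℂ) ρ, R s z = c *
      ∏ k ∈ s', ((if k ∈ K then z + (b k : ℂ) else 1) / if k ∈ K ∧ k ∈ N then z + (a k : ℂ) else 1))
    (hB : ∃ B : ℝ, ∀ᶠ s in atTop, ∀ z ∈ sphere (0 : ℂ) ρ, ‖R s z‖ ≤ B)
    (hlim : ∀ z ∈ sphere (0 : ℂ) ρ, Tendsto (fun s => R s z) atTop (𝓝 (F z))) :
    HurwitzPair ρ (fun z => f z * W z) fun z => f z * W z * F z := by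
  have hfW := ((hf.isMultiplier hρ).mul' hW).cont
  obtain ⟨A, hA⟩ := (isCompact_sphere (0 : ℂ) ρ).exists_bound_of_continuousOn hfW
  obtain ⟨B, hB⟩ := hB
  refine HurwitzPair.of_tendsto hρ (l := atTop) (F := fun (_ : Finset ℤ) z => f z * W z)
    (G := fun s z => f z * W z * R s z) (fun s => ?_) hfW (hfW.mul hF) (K := A) (L := A * B)
    (Eventually.of_forall fun _ => hA) (hB.mono fun s hs z hz => ?_)
    (fun z _ => tendsto_const_nhds) fun z hz => (hlim z hz).const_mul _
  · obtain ⟨c, hc, s', hs'⟩ := hR s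
    refine ((h.hurwitzPair_finite hρ hf hW h0 hne s').const_mul_right hc).congr hρ
      (fun z _ => rfl) fun z hz => ?_
    simp only
    rw [hs' z hz]
    ring
  · rw [norm_mul]
    exact mul_le_mul (hA z hz) (hs z hz) (norm_nonneg _) ((norm_nonneg _).trans (hA z hz))

end InterlacingParams

/-! ### Products over signed indices as canonical products -/

open Classical in
/-- The reciprocals of the parameters with positive index in `S`. -/
noncomputable def posInv (S : Set ℤ) (c : ℤ → ℝ) (k : ℤ) : ℝ :=
  if k ∈ S ∧ 0 < k then (c k)⁻¹ else 0

open Classical in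
/-- The reciprocals of the parameters with negative index in `S`. -/
noncomputable def negInv (S : Set ℤ) (c : ℤ → ℝ) (k : ℤ) : ℝ :=
  if k ∈ S ∧ k < 0 then (c k)⁻¹ else 0

theorem AdmissibleParams.posInv_nonneg {S : Set ℤ} {c : ℤ → ℝ} (h : AdmissibleParams S c) (k : ℤ) :
    0 ≤ posInv S c k := by
  unfold posInv
  split_ifs with hk
  · exact (inv_pos.2 (h.pos k hk.1 hk.2.ne')).le
  · exact le_rfl

theorem AdmissibleParams.negInv_nonneg {S : Set ℤ} {c : ℤ → ℝ} (h : AdmissibleParams S c) (k : ℤ) :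
    0 ≤ negInv S c k := by
  unfold negInv
  split_ifs with hk
  · exact (inv_pos.2 (h.pos k hk.1 hk.2.ne)).le
  · exact le_rfl

theorem AdmissibleParams.summable_posInv {S : Set ℤ} {c : ℤ → ℝ} (h : AdmissibleParams S c) :
    Summable (posInv S c) := by
  have := summable_subtype_iff_indicator (s := {k | k ∈ S ∧ 0 < k}) (f := fun k => (c k)⁻¹)
    |>.1 h.summable_pos
  refine this.congr fun k => ?_
  unfold posInv
  split_ifs with hk
  · exact Set.indicator_of_mem (s := {k | k ∈ S ∧ 0 < k}) hk _
  · exact Set.indicator_of_notMem (s := {k | k ∈ S ∧ 0 < k}) hk _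

theorem AdmissibleParams.summable_negInv {S : Set ℤ} {c : ℤ → ℝ} (h : AdmissibleParams S c) :
    Summable (negInv S c) := by
  have := summable_subtype_iff_indicator (s := {k | k ∈ S ∧ k < 0}) (f := fun k => (c k)⁻¹)
    |>.1 h.summable_neg
  refine this.congr fun k => ?_
  unfold negInv
  split_ifs with hk
  · exact Set.indicator_of_mem (s := {k | k ∈ S ∧ k < 0}) hk _
  · exact Set.indicator_of_notMem (s := {k | k ∈ S ∧ k < 0}) hk _

/-- The parameter `t` covers both signs: t = 1 for the products over zeros, t = -1 for the
denominators in Edrei's form. -/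
theorem tprod_posIdx_one_add (S : Set ℤ) (c : ℤ → ℝ) (t : ℝ) (z : ℂ) :
    ∏' k : PosIdx S, (1 + t * (z / (c k : ℂ))) = linProd (fun k => t * posInv S c k) z := by
  have := tprod_subtype {k | k ∈ S ∧ 0 < k} (fun k => 1 + t * (z / (c k : ℂ)))
  refine this.trans (tprod_congr fun k => ?_)
  unfold posInv
  beta_reduce
  split_ifs with hk
  · rw [Set.mulIndicator_of_mem (s := {k | k ∈ S ∧ 0 < k}) hk]
    push_cast
    ring
  · rw [Set.mulIndicator_of_notMem (s := {k | k ∈ S ∧ 0 < k}) hk]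
    simp

theorem tprod_negIdx_one_add (S : Set ℤ) (c : ℤ → ℝ) (t : ℝ) (z : ℂ) :
    ∏' k : NegIdx S, (1 + t * (z / (c k : ℂ))) = linProd (fun k => t * negInv S c k) z := by
  have := tprod_subtype {k | k ∈ S ∧ k < 0} (fun k => 1 + t * (z / (c k : ℂ)))
  refine this.trans (tprod_congr fun k => ?_)
  unfold negInv
  beta_reduce
  split_ifs with hk
  · rw [Set.mulIndicator_of_mem (s := {k | k ∈ S ∧ k < 0}) hk]
    push_cast
    ring
  · rw [Set.mulIndicator_of_notMem (s := {k | k ∈ S ∧ k < 0}) hk]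
    simp

theorem posProd_eq_linProd (S : Set ℤ) (c : ℤ → ℝ) (z : ℂ) :
    posProd S c z = linProd (posInv S c) z := by
  simpa [posProd] using tprod_posIdx_one_add S c 1 z

theorem negProd_eq_linProd (S : Set ℤ) (c : ℤ → ℝ) (z : ℂ) :
    negProd S c z = linProd (negInv S c) z⁻¹ := by
  simpa [negProd] using tprod_negIdx_one_add S c 1 z⁻¹

/-! ### Edrei's form: zeros, poles and analytic continuation -/

namespace EdreiData

variable (e : EdreiData)

/-- The factors of a function of Edrei's form that carry its zeros. -/
noncomputable def zeroPart (z : ℂ) : ℂ :=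
  e.C * z ^ e.j * linProd (posInv e.M e.β) z * linProd (negInv e.M e.β) z⁻¹

/-- The factors of a function of Edrei's form without zeros. -/
noncomputable def polePart (z : ℂ) : ℂ :=
  Complex.exp (e.A * z) * Complex.exp (e.A₀ * z⁻¹) *
    (linProd (fun k => -posInv e.N e.δ k) z)⁻¹ * (linProd (fun k => -negInv e.N e.δ k) z⁻¹)⁻¹

theorem eval_eq (z : ℂ) : e.eval z = e.zeroPart z * e.polePart z := by
  have h1 := tprod_posIdx_one_add e.N e.δ (-1) z
  have h2 := tprod_negIdx_one_add e.N e.δ (-1) z⁻¹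
  simp only [Complex.ofReal_neg, Complex.ofReal_one, neg_mul, one_mul, ← sub_eq_add_neg] at h1 h2
  unfold eval zeroPart polePart
  rw [h1, h2, posProd_eq_linProd, negProd_eq_linProd, Complex.exp_add]
  simp only [div_eq_mul_inv]
  ring

theorem isCanonicalProd_zeroPart : IsCanonicalProd e.zeroPart :=
  ⟨e.C, e.j, _, _, e.C_pos, e.β_admissible.summable_posInv, e.β_admissible.summable_negInv,
    e.β_admissible.posInv_nonneg, e.β_admissible.negInv_nonneg, fun _ _ => rfl⟩

theorem posInv_mul_lt_one {ρ R : ℝ} (hρ : 0 < ρ) (hR : ρ < R)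
    (h : ∀ ν ∈ e.N, 0 < ν → R ≤ e.δ ν) (k : ℤ) : posInv e.N e.δ k * ρ < 1 := by
  unfold posInv
  split_ifs with hk
  · have h3 := h k hk.1 hk.2
    rw [inv_mul_eq_div, div_lt_one (by linarith)]
    linarith
  · simp

theorem negInv_lt {ρ r : ℝ} (hρ : 0 < ρ) (hr : r < ρ)
    (h : ∀ ν ∈ e.N, ν < 0 → (e.δ ν)⁻¹ ≤ r) (k : ℤ) : negInv e.N e.δ k < ρ := by
  unfold negInv
  split_ifs with hk
  · exact (h k hk.1 hk.2).trans_lt hr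
  · exact hρ

theorem isMultiplier_polePart {ρ r R : ℝ} (hρ : 0 < ρ) (hr : r < ρ) (hR : ρ < R)
    (h1 : ∀ ν ∈ e.N, 0 < ν → R ≤ e.δ ν) (h2 : ∀ ν ∈ e.N, ν < 0 → (e.δ ν)⁻¹ ≤ r) :
    IsMultiplier ρ e.polePart :=
  (((IsMultiplier.exp_mul hρ e.A_nonneg).mul' (IsMultiplier.exp_mul_inv hρ e.A₀_nonneg)).mul'
    (IsMultiplier.inv_linProd_neg hρ e.δ_admissible.summable_posInv e.δ_admissible.posInv_nonneg
      (e.posInv_mul_lt_one hρ hR h1))).mul' (IsMultiplier.inv_linProd_neg_inv hρ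
      e.δ_admissible.summable_negInv e.δ_admissible.negInv_nonneg (e.negInv_lt hρ hr h2))

theorem polePart_ne_zero_of_mem_sphere {ρ r R : ℝ} (hρ : 0 < ρ) (hr : r < ρ) (hR : ρ < R)
    (h1 : ∀ ν ∈ e.N, 0 < ν → R ≤ e.δ ν) (h2 : ∀ ν ∈ e.N, ν < 0 → (e.δ ν)⁻¹ ≤ r) {z : ℂ}
    (hz : z ∈ sphere (0 : ℂ) ρ) : e.polePart z ≠ 0 := by
  refine mul_ne_zero (mul_ne_zero (mul_ne_zero (Complex.exp_ne_zero _) (Complex.exp_ne_zero _))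
    (inv_ne_zero ?_)) (inv_ne_zero ?_)
  · refine linProd_ne_zero e.δ_admissible.summable_posInv.neg fun k =>
      IsMultiplier.one_add_neg_ne_zero (e.δ_admissible.posInv_nonneg k) ?_
    rw [mem_sphere_zero_iff_norm.1 hz]
    exact e.posInv_mul_lt_one hρ hR h1 k
  · refine linProd_ne_zero e.δ_admissible.summable_negInv.neg fun k =>
      IsMultiplier.one_add_neg_ne_zero (e.δ_admissible.negInv_nonneg k) ?_
    rw [norm_inv_eq_of_mem_sphere hz, ← div_eq_mul_inv, div_lt_one hρ]
    exact e.negInv_lt hρ hr h2 k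

theorem one_add_real_mul_ne_zero {x : ℝ} (hx : 0 ≤ x) {z : ℂ} (hz : z ∈ Complex.slitPlane) :
    1 + (x : ℂ) * z ≠ 0 := by
  intro h
  have hre := congrArg Complex.re h
  have him := congrArg Complex.im h
  simp at hre him
  rcases him with h0 | h0
  · rw [h0] at hre
    simp at hre
  · rcases hz with h1 | h1
    · nlinarith
    · exact h1 h0

theorem inv_mem_slitPlane {z : ℂ} (hz : z ∈ Complex.slitPlane) : z⁻¹ ∈ Complex.slitPlane := by
  have hz0 := Complex.slitPlane_ne_zero hz
  have hn := Complex.normSq_pos.2 hz0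
  rcases hz with h | h
  · left
    rw [Complex.inv_re]
    exact div_pos h hn
  · right
    rw [Complex.inv_im]
    exact div_ne_zero (neg_ne_zero.2 h) hn.ne'

theorem linProd_neg_neg_ne_zero {u : ℤ → ℝ} (hu : Summable u) (h0 : ∀ k, 0 ≤ u k) {z : ℂ}
    (hz : z ∈ Complex.slitPlane) : linProd (fun k => -u k) (-z) ≠ 0 := by
  refine linProd_ne_zero hu.neg fun k => ?_
  simpa using one_add_real_mul_ne_zero (h0 k) hz

theorem polePart_neg_ne_zero {z : ℂ} (hz : z ∈ Complex.slitPlane) : e.polePart (-z) ≠ 0 := by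
  unfold polePart
  refine mul_ne_zero (mul_ne_zero (mul_ne_zero (Complex.exp_ne_zero _) (Complex.exp_ne_zero _))
    (inv_ne_zero ?_)) (inv_ne_zero ?_)
  · exact linProd_neg_neg_ne_zero e.δ_admissible.summable_posInv e.δ_admissible.posInv_nonneg hz
  · rw [inv_neg]
    exact linProd_neg_neg_ne_zero e.δ_admissible.summable_negInv e.δ_admissible.negInv_nonneg
      (inv_mem_slitPlane hz)

/-- All poles lie on the positive axis; the reflection z ↦ -z moves them, together with 0, onto the
cut of the slit plane. -/
theorem differentiableOn_eval_neg :
    DifferentiableOn ℂ (fun z => e.eval (-z)) Complex.slitPlane := by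
  intro z hz
  have hz0 := Complex.slitPlane_ne_zero hz
  have hinv : DifferentiableAt ℂ (fun w : ℂ => (-w)⁻¹) z :=
    differentiableAt_id.neg.inv (neg_ne_zero.2 hz0)
  have hneg : DifferentiableAt ℂ (fun w : ℂ => -w) z := differentiableAt_id.neg
  have hzpow : DifferentiableAt ℂ (fun w : ℂ => (-w) ^ e.j) z :=
    hneg.zpow (Or.inl (neg_ne_zero.2 hz0))
  have hpos : ∀ {x : ℤ → ℝ}, Summable x → DifferentiableAt ℂ (fun w : ℂ => linProd x (-w)) z :=
    fun hx => (linProd_differentiable hx _).comp z hneg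
  have hnegp : ∀ {x : ℤ → ℝ}, Summable x → DifferentiableAt ℂ (fun w : ℂ => linProd x (-w)⁻¹) z :=
    fun hx => (linProd_differentiable hx _).comp z hinv
  have h1 := (((hzpow.const_mul (e.C : ℂ)).mul (hpos e.β_admissible.summable_posInv)).mul
    (hnegp e.β_admissible.summable_negInv))
  have h2 := (((hneg.const_mul (e.A : ℂ)).cexp.mul (hinv.const_mul (e.A₀ : ℂ)).cexp).mul
    ((hpos e.δ_admissible.summable_posInv.neg).inv (linProd_neg_neg_ne_zero
      e.δ_admissible.summable_posInv e.δ_admissible.posInv_nonneg hz))).mul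
    ((hnegp e.δ_admissible.summable_negInv.neg).inv (by
      rw [inv_neg]
      exact linProd_neg_neg_ne_zero e.δ_admissible.summable_negInv e.δ_admissible.negInv_nonneg
        (inv_mem_slitPlane hz)))
  refine ((h1.mul h2).congr_of_eventuallyEq
    (Eventually.of_forall fun w => ?_)).differentiableWithinAt
  simp only [eval_eq, zeroPart, polePart]
  rfl

theorem zeroPart_ne_zero {z : ℂ} (hz : z ≠ 0)
    (h1 : ∀ k ∈ e.M, 0 < k → 1 + ((e.β k)⁻¹ : ℝ) * z ≠ 0)
    (h2 : ∀ k ∈ e.M, k < 0 → 1 + ((e.β k)⁻¹ : ℝ) * z⁻¹ ≠ 0) : e.zeroPart z ≠ 0 := by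
  refine mul_ne_zero (mul_ne_zero (mul_ne_zero (Complex.ofReal_ne_zero.2 e.C_pos.ne')
    (zpow_ne_zero _ hz)) (linProd_ne_zero e.β_admissible.summable_posInv fun k => ?_))
    (linProd_ne_zero e.β_admissible.summable_negInv fun k => ?_)
  · unfold posInv
    split_ifs with hk
    · exact h1 k hk.1 hk.2
    · simp
  · unfold negInv
    split_ifs with hk
    · exact h2 k hk.1 hk.2
    · simp

theorem eval_ne_zero_of_im_ne_zero {z : ℂ} (hz : z.im ≠ 0) : e.eval z ≠ 0 := by
  have hs : z ∈ Complex.slitPlane := Or.inr hz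
  have hs' : -z ∈ Complex.slitPlane := Or.inr (by simpa using hz)
  rw [eval_eq]
  refine mul_ne_zero (e.zeroPart_ne_zero (Complex.slitPlane_ne_zero hs) (fun k hk h => ?_)
    fun k hk h => ?_) ?_
  · exact one_add_real_mul_ne_zero (inv_pos.2 (e.β_admissible.pos k hk h.ne')).le hs
  · exact one_add_real_mul_ne_zero (inv_pos.2 (e.β_admissible.pos k hk h.ne)).le
      (inv_mem_slitPlane hs)
  · simpa using e.polePart_neg_ne_zero hs'

theorem zeroPart_ne_zero_of_mem_sphere {ρ : ℝ} (hρ : 0 < ρ) (h1 : ∀ k, e.β k ≠ ρ)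
    (h2 : ∀ k, (e.β k)⁻¹ ≠ ρ) {z : ℂ} (hz : z ∈ sphere (0 : ℂ) ρ) : e.zeroPart z ≠ 0 := by
  have hn := mem_sphere_zero_iff_norm.1 hz
  refine e.zeroPart_ne_zero (ne_zero_of_mem_sphere_zero hρ hz) (fun k hk h h0 => ?_)
    fun k hk h h0 => ?_
  · have hp := e.β_admissible.pos k hk h.ne'
    have h3 := congrArg norm (eq_neg_of_add_eq_zero_right h0)
    rw [norm_neg, norm_one, norm_mul, Complex.norm_real, hn, Real.norm_of_nonneg (by positivity),
      inv_mul_eq_one₀ hp.ne'] at h3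
    exact h1 k h3
  · have hp := e.β_admissible.pos k hk h.ne
    have h3 := congrArg norm (eq_neg_of_add_eq_zero_right h0)
    rw [norm_neg, norm_one, norm_mul, Complex.norm_real,
      norm_inv_eq_of_mem_sphere hz, Real.norm_of_nonneg (by positivity),
      mul_inv_eq_one₀ hρ.ne'] at h3
    exact h2 k h3

/-- Analytic continuation of the ratio of two functions of Edrei's form: the negative poles of the
ratio are zeros of the denominator. -/
theorem zeroPart_neg_eq_zero {e e' : EdreiData} {P Q : ℂ → ℂ} {r R : ℝ} (hr : 0 ≤ r) (hrR : r < R)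
    (hP : ∀ z, z ≠ 0 → DifferentiableAt ℂ P z) (hQ : ∀ z, z ≠ 0 → DifferentiableAt ℂ Q z)
    (h : ∀ z ∈ annulus r R, z.im ≠ 0 → e'.eval z * P z = e.eval z * Q z) {a : ℝ} (ha : 0 < a)
    (hPa : P (-a) = 0) (hQa : Q (-a) ≠ 0) : e.zeroPart (-a) = 0 := by
  have hcomp : ∀ {g : ℂ → ℂ}, (∀ z, z ≠ 0 → DifferentiableAt ℂ g z) →
      DifferentiableOn ℂ (fun z => g (-z)) Complex.slitPlane := fun {g} hg z hz =>
    ((hg (-z) (neg_ne_zero.2 (Complex.slitPlane_ne_zero hz))).comp z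
      differentiableAt_id.neg).differentiableWithinAt
  have hG : AnalyticOnNhd ℂ (fun z => e'.eval (-z) * P (-z) - e.eval (-z) * Q (-z))
      Complex.slitPlane :=
    ((e'.differentiableOn_eval_neg.mul (hcomp hP)).sub
      (e.differentiableOn_eval_neg.mul (hcomp hQ))).analyticOnNhd Complex.isOpen_slitPlane
  have hconn : IsPreconnected Complex.slitPlane :=
    (Complex.starConvex_one_slitPlane.isPathConnected
      Complex.one_mem_slitPlane).isConnected.isPreconnected
  -- Any nonreal point of the annulus would do: the identity is assumed only off the real axis,
  -- where functions of Edrei's form have no zeros.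
  set z₀ : ℂ := ((r + R) / 2 : ℝ) * Complex.I with hz₀
  have hpos : 0 < (r + R) / 2 := by linarith
  have him : z₀.im ≠ 0 := by
    rw [hz₀]
    simpa using hpos.ne'
  have hnorm : ‖z₀‖ = (r + R) / 2 := by
    rw [hz₀, norm_mul, Complex.norm_I, mul_one, Complex.norm_real, Real.norm_of_nonneg hpos.le]
  have hev : (fun z => e'.eval (-z) * P (-z) - e.eval (-z) * Q (-z)) =ᶠ[𝓝 z₀] 0 := by
    have hopen : IsOpen {z : ℂ | (r < ‖z‖ ∧ ‖z‖ < R) ∧ z.im ≠ 0} :=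
      ((isOpen_lt continuous_const continuous_norm).inter
        (isOpen_lt continuous_norm continuous_const)).inter
        (isOpen_ne_fun Complex.continuous_im continuous_const)
    filter_upwards [hopen.mem_nhds (show z₀ ∈ _ from
      ⟨⟨by rw [hnorm]; linarith, by rw [hnorm]; linarith⟩, him⟩)] with z hz
    have := h (-z) (by simpa [annulus] using hz.1) (by simpa using hz.2)
    simp only [Pi.zero_apply]
    rw [this, sub_self]
  have ha' : (a : ℂ) ∈ Complex.slitPlane := Or.inl (by simpa using ha)
  have := hG.eqOn_zero_of_preconnected_of_eventuallyEq_zero hconn (Or.inr him) hev ha'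
  simp only [Pi.zero_apply, hPa, mul_zero, zero_sub, neg_eq_zero, mul_eq_zero, hQa,
    or_false] at this
  rw [eval_eq] at this
  exact (mul_eq_zero.1 this).resolve_right (e.polePart_neg_ne_zero ha')

end EdreiData

/-! ### From a ratio to total nonnegativity -/

theorem exists_generic_radius {r R : ℝ} (hrR : r < R) (c : ℕ → ℤ → ℝ) :
    ∃ ρ, r < ρ ∧ ρ < R ∧ ∀ n k, c n k ≠ ρ := by
  have hc : (⋃ n, Set.range (c n)).Countable := Set.countable_iUnion fun n => Set.countable_range _
  have h1 : ¬ Set.Ioo r R ⊆ ⋃ n, Set.range (c n) := fun hsub =>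
    hrR.not_ge (Cardinal.Real.Ioo_countable_iff.1 (hc.mono hsub))
  obtain ⟨ρ, hρ, hn⟩ := Set.not_subset.1 h1
  refine ⟨ρ, hρ.1, hρ.2, fun n k h => hn (Set.mem_iUnion.2 ⟨n, k, h⟩)⟩

-- The common core of both representations: `P` and `Q` are the full denominator and numerator of
-- `F`, and `S` its finite approximations.
open Classical in
theorem hurwitzType_tnn_of_ratio {a b : ℤ → ℝ} {p q F : ℂ → ℂ} {r R : ℝ} (hr : 0 ≤ r) (hrR : r < R)
    (ha : HasLaurentSeriesOn a p r R) (hb : HasLaurentSeriesOn b q r R)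
    (hp : HasEdreiForm p r R) (hq : HasEdreiForm q r R)
    (hquot : ∀ z ∈ annulus r R, p z ≠ 0 → q z / p z = F z)
    {K N : Set ℤ} {α β : ℤ → ℝ} (hK : InterlacingParams K N α β) {P Q : ℂ → ℂ}
    (hP : ∀ z, z ≠ 0 → DifferentiableAt ℂ P z) (hQ : ∀ z, z ≠ 0 → DifferentiableAt ℂ Q z)
    (hF : ∀ z, z ≠ 0 → F z = Q z / P z)
    (hP0 : ∀ z, z ≠ 0 → (P z = 0 ↔ ∃ k ∈ K, k ∈ N ∧ z = -(α k : ℂ)))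
    (hQ0 : ∀ k ∈ K, k ∈ N → Q (-(α k : ℂ)) ≠ 0) {S : Finset ℤ → ℂ → ℂ}
    (hS : ∀ s, ∃ c : ℝ, 0 ≤ c ∧ ∃ s' : Finset ℤ, ∀ z, z ≠ 0 → S s z = c *
      ∏ k ∈ s', ((if k ∈ K then z + (β k : ℂ) else 1) / if k ∈ K ∧ k ∈ N then z + (α k : ℂ) else 1))
    (hB : ∀ ρ : ℝ, 0 < ρ → (∀ k ∈ K, k ∈ N → α k ≠ ρ) →
      ∃ B : ℝ, ∀ᶠ s in atTop, ∀ z ∈ sphere (0 : ℂ) ρ, ‖S s z‖ ≤ B)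
    (hlim : ∀ z, z ≠ 0 → P z ≠ 0 → Tendsto (fun s => S s z) atTop (𝓝 (F z))) :
    TotallyNonnegative (hurwitzType a b) := by
  obtain ⟨e, he1, he2, he⟩ := hp
  obtain ⟨e', -, -, he'⟩ := hq
  -- The zeros of `p` have moduli β_k for k > 0 and 1/β_k for k < 0, so the circle is made to avoid
  -- both families.
  obtain ⟨ρ, hrρ, hρR, hgen⟩ := exists_generic_radius hrR
    fun n k => if n = 0 then e.β k else (e.β k)⁻¹
  have hρ : 0 < ρ := hr.trans_lt hrρ
  have hαC : ∀ k ∈ K, k ∈ N → (-(α k : ℂ)) ≠ 0 := fun k hk hkN =>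
    neg_ne_zero.2 (Complex.ofReal_ne_zero.2 (hK.pos hk hkN).ne')
  have hzero : ∀ k ∈ K, k ∈ N → e.zeroPart (-(α k : ℂ)) = 0 := by
    intro k hk hkN
    refine EdreiData.zeroPart_neg_eq_zero (e' := e') hr hrR hP hQ (fun z hz him => ?_)
      (hK.pos hk hkN) ((hP0 _ (hαC k hk hkN)).2 ⟨k, hk, hkN, rfl⟩) (hQ0 k hk hkN)
    have hz0 : z ≠ 0 := by
      rintro rfl
      simp at him
    have hpz : p z ≠ 0 := by
      rw [he z hz]
      exact e.eval_ne_zero_of_im_ne_zero him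
    have hPz : P z ≠ 0 := by
      rw [Ne, hP0 z hz0]
      rintro ⟨l, -, -, rfl⟩
      simp at him
    have h1 := hquot z hz hpz
    rw [hF z hz0, div_eq_div_iff hpz hPz] at h1
    rw [← he z hz, ← he' z hz, h1]
    ring
  have hsph : ∀ z ∈ sphere (0 : ℂ) ρ, e.zeroPart z ≠ 0 := fun z hz =>
    e.zeroPart_ne_zero_of_mem_sphere hρ (fun k => by simpa using hgen 0 k)
      (fun k => by simpa using hgen 1 k) hz
  -- The poles of `F`, being zeros of `e.zeroPart`, are avoided automatically.
  have hne : ∀ k ∈ K, k ∈ N → α k ≠ ρ := by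
    intro k hk hkN h
    refine hsph (-(α k : ℂ)) ?_ (hzero k hk hkN)
    rw [mem_sphere_zero_iff_norm, norm_neg, Complex.norm_real, h, Real.norm_of_nonneg hρ.le]
  have hPs : ∀ z ∈ sphere (0 : ℂ) ρ, P z ≠ 0 := by
    intro z hz
    rw [Ne, hP0 z (ne_zero_of_mem_sphere_zero hρ hz)]
    rintro ⟨k, hk, hkN, rfl⟩
    exact hsph _ hz (hzero k hk hkN)
  have hFc : ContinuousOn F (sphere 0 ρ) := by
    have h1 : ContinuousOn (fun z => Q z / P z) (sphere 0 ρ) := fun z hz =>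
      have hz0 := ne_zero_of_mem_sphere_zero hρ hz
      (((hQ z hz0).continuousAt).div (hP z hz0).continuousAt (hPs z hz)).continuousWithinAt
    exact h1.congr fun z hz => hF z (ne_zero_of_mem_sphere_zero hρ hz)
  have hmult := e.isMultiplier_polePart hρ hrρ hρR he1 he2
  have hpair := hK.hurwitzPair hρ e.isCanonicalProd_zeroPart hmult hzero hne hFc (R := S)
    (fun s => by
      obtain ⟨c, hc, s', hs'⟩ := hS s
      exact ⟨c, hc, s', fun z hz => hs' z (ne_zero_of_mem_sphere_zero hρ hz)⟩)
    (hB ρ hρ hne) fun z hz => hlim z (ne_zero_of_mem_sphere_zero hρ hz) (hPs z hz)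
  have hann : ∀ z ∈ sphere (0 : ℂ) ρ, z ∈ annulus r R := fun z hz => by
    have := mem_sphere_zero_iff_norm.1 hz
    exact ⟨by rw [this]; exact hrρ, by rw [this]; exact hρR⟩
  have hpz : ∀ z ∈ sphere (0 : ℂ) ρ, p z = e.zeroPart z * e.polePart z := fun z hz => by
    rw [he z (hann z hz), e.eval_eq]
  have hp0 : ∀ z ∈ sphere (0 : ℂ) ρ, p z ≠ 0 := fun z hz => by
    rw [hpz z hz]
    exact mul_ne_zero (hsph z hz) (e.polePart_ne_zero_of_mem_sphere hρ hrρ hρR he1 he2 hz)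
  have hfin := hpair.congr hρ (f' := p) (g' := q) hpz fun z hz => by
    simp only
    rw [← hpz z hz, ← hquot z (hann z hz) (hp0 z hz), mul_div_cancel₀ _ (hp0 z hz)]
  have := hfin.tnn
  rwa [circleCoeff_of_hasSum hρ fun z hz => ha z (hann z hz),
    circleCoeff_of_hasSum hρ fun z hz => hb z (hann z hz)] at this

/-- The pair (p, 0) is (1, 0) times the multiplier p. -/
theorem hurwitzType_zero_tnn {a b : ℤ → ℝ} {p q : ℂ → ℂ} {r R : ℝ} (hr : 0 ≤ r) (hrR : r < R)
    (ha : HasLaurentSeriesOn a p r R) (hb : HasLaurentSeriesOn b q r R)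
    (hp : HasEdreiForm p r R) (hq : ∀ z ∈ annulus r R, q z = 0) :
    TotallyNonnegative (hurwitzType a b) := by
  obtain ⟨e, he1, he2, he⟩ := hp
  obtain ⟨ρ, hrρ, hρR⟩ := exists_between hrR
  have hρ : 0 < ρ := hr.trans_lt hrρ
  have hann : ∀ z ∈ sphere (0 : ℂ) ρ, z ∈ annulus r R := fun z hz => by
    have := mem_sphere_zero_iff_norm.1 hz
    exact ⟨by rw [this]; exact hrρ, by rw [this]; exact hρR⟩
  have hm := (e.isCanonicalProd_zeroPart.isMultiplier hρ).mul'
    (e.isMultiplier_polePart hρ hrρ hρR he1 he2)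
  have := ((hm.mul _ _ (HurwitzPair.one_zero hρ)).congr hρ (f' := p) (g' := q)
    (fun z hz => by simp [he z (hann z hz), e.eval_eq])
    fun z hz => by simp [hq z (hann z hz)]).tnn
  rwa [circleCoeff_of_hasSum hρ fun z hz => ha z (hann z hz),
    circleCoeff_of_hasSum hρ fun z hz => hb z (hann z hz)] at this

/-! ### Interlacing chains and partial products -/

theorem interlacing_chain {M N : Set ℤ} {α β : ℤ → ℝ} {L : ℤ}
    (h1 : ∀ n, L ≤ n → n ∈ N → n ∈ M ∧ β n < α n)
    (h2 : ∀ n, L ≤ n → n + 1 ∈ M → n ∈ N ∧ α n < β (n + 1)) {k l : ℤ} (hk : L ≤ k) (hkl : k < l)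
    (hl : l ∈ M) : k ∈ N ∧ α k < β l := by
  obtain ⟨m, rfl⟩ : ∃ m : ℕ, l = k + 1 + m := ⟨(l - (k + 1)).toNat, by omega⟩
  clear hkl
  induction m with
  | zero =>
    simp only [Nat.cast_zero, add_zero] at hl ⊢
    exact h2 k hk hl
  | succ m ih =>
    have e : k + 1 + ((m + 1 : ℕ) : ℤ) = k + 1 + m + 1 := by push_cast; ring
    rw [e] at hl ⊢
    have h3 := h2 (k + 1 + m) (by omega) hl
    have h4 := h1 (k + 1 + m) (by omega) h3.1
    have h5 := ih h4.1
    exact ⟨h5.1, h5.2.trans (h4.2.trans h3.2)⟩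

/-- Negating indices and values exchanges zeros and poles and reduces this to the positive half of
the chain. -/
theorem interlacing_chain_neg {M N : Set ℤ} {α β : ℤ → ℝ}
    (h1 : ∀ n, n < 0 → n ∈ M → n ∈ N ∧ β n < α n)
    (h2 : ∀ n, n < 0 → n - 1 ∈ N → n ∈ M ∧ α (n - 1) < β n) {k l : ℤ} (hl : l < 0) (hkl : k < l)
    (hk : k ∈ N) : l ∈ M ∧ α k < β l := by
  have := interlacing_chain (M := {k | -k ∈ N}) (N := {k | -k ∈ M}) (α := fun k => -β (-k))
    (β := fun k => -α (-k)) (L := 1) (k := -l) (l := -k)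
    (fun n hn hnM => ⟨(h1 (-n) (by omega) hnM).1, neg_lt_neg (h1 (-n) (by omega) hnM).2⟩)
    (fun n hn hnM => by
      have e : -(n + 1) = -n - 1 := by ring
      have h3 := h2 (-n) (by omega) (by
        rw [← e]
        exact hnM)
      refine ⟨h3.1, ?_⟩
      rw [e]
      exact neg_lt_neg h3.2) (by omega) (by omega) (by simpa using hk)
  simpa using this

/-- The partial products of `∏ (1 + x_k w) / ∏ (1 + y_k w)` are bounded on circles that avoid the
poles. -/
theorem exists_bound_prod_div {x y : ℤ → ℝ} (hx : Summable x) (hy : Summable y) {r : ℝ}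
    (h : ∀ k, |y k| * r ≠ 1) : ∃ B : ℝ, ∀ᶠ s : Finset ℤ in atTop, ∀ w : ℂ, ‖w‖ = r →
      ‖(∏ k ∈ s, (1 + (x k : ℂ) * w)) / ∏ k ∈ s, (1 + (y k : ℂ) * w)‖ ≤ B := by
  obtain ⟨K, hK⟩ := exists_norm_inv_prod_one_add_mul_le hy h
  refine ⟨Real.exp ((∑' k, |x k|) * r) * K, hK.mono fun s hs w hw => ?_⟩
  have h1 := norm_prod_one_add_mul_le hx s w
  rw [hw] at h1
  rw [div_eq_mul_inv, norm_mul]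
  exact mul_le_mul h1 (hs w hw) (norm_nonneg _) (Real.exp_pos _).le

theorem prod_div_tendsto {x y : ℤ → ℝ} (hx : Summable x) (hy : Summable y) {w : ℂ}
    (h : linProd y w ≠ 0) : Tendsto (fun s : Finset ℤ => (∏ k ∈ s, (1 + (x k : ℂ) * w)) /
      ∏ k ∈ s, (1 + (y k : ℂ) * w)) atTop (𝓝 (linProd x w / linProd y w)) :=
  (linProd_tendsto hx w).div (linProd_tendsto hy w) h

theorem exists_one_add_mul_eq_zero {x : ℤ → ℝ} (hx : Summable x) {z : ℂ} (h : linProd x z = 0) :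
    ∃ k, 1 + (x k : ℂ) * z = 0 := by
  by_contra! h'
  exact linProd_ne_zero hx h' h

theorem one_add_inv_mul_eq_zero_iff {c : ℝ} (hc : c ≠ 0) {z : ℂ} :
    1 + ((c⁻¹ : ℝ) : ℂ) * z = 0 ↔ z = -(c : ℂ) := by
  have hc' : (c : ℂ) ≠ 0 := Complex.ofReal_ne_zero.2 hc
  push_cast
  constructor
  · intro h
    field_simp at h
    linear_combination h
  · rintro rfl
    field_simp
    ring

theorem one_add_inv_mul_inv_eq_zero_iff {c : ℝ} (hc : c ≠ 0) {z : ℂ} :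
    1 + ((c⁻¹ : ℝ) : ℂ) * z⁻¹ = 0 ↔ z = -((c⁻¹ : ℝ) : ℂ) := by
  rw [one_add_inv_mul_eq_zero_iff hc]
  push_cast
  rw [inv_eq_iff_eq_inv, inv_neg]

section posInv

variable {S : Set ℤ} {c : ℤ → ℝ}

theorem linProd_posInv_eq_zero_iff (h : AdmissibleParams S c) {z : ℂ} :
    linProd (posInv S c) z = 0 ↔ ∃ k ∈ S, 0 < k ∧ z = -(c k : ℂ) := by
  constructor
  · intro h0
    obtain ⟨k, hk⟩ := exists_one_add_mul_eq_zero h.summable_posInv h0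
    unfold posInv at hk
    split_ifs at hk with hkS
    · exact ⟨k, hkS.1, hkS.2, (one_add_inv_mul_eq_zero_iff (h.pos k hkS.1 hkS.2.ne').ne').1 hk⟩
    · simp at hk
  · rintro ⟨k, hkS, hk0, hz⟩
    refine linProd_eq_zero h.summable_posInv (k := k) ?_
    unfold posInv
    rw [if_pos ⟨hkS, hk0⟩]
    exact (one_add_inv_mul_eq_zero_iff (h.pos k hkS hk0.ne').ne').2 hz

theorem linProd_negInv_eq_zero_iff (h : AdmissibleParams S c) {z : ℂ} :
    linProd (negInv S c) z⁻¹ = 0 ↔ ∃ k ∈ S, k < 0 ∧ z = -(((c k)⁻¹ : ℝ) : ℂ) := by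
  constructor
  · intro h0
    obtain ⟨k, hk⟩ := exists_one_add_mul_eq_zero h.summable_negInv h0
    unfold negInv at hk
    split_ifs at hk with hkS
    · exact ⟨k, hkS.1, hkS.2,
        (one_add_inv_mul_inv_eq_zero_iff (h.pos k hkS.1 hkS.2.ne).ne').1 hk⟩
    · simp at hk
  · rintro ⟨k, hkS, hk0, hz⟩
    refine linProd_eq_zero h.summable_negInv (k := k) ?_
    unfold negInv
    rw [if_pos ⟨hkS, hk0⟩]
    exact (one_add_inv_mul_inv_eq_zero_iff (h.pos k hkS hk0.ne).ne').2 hz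

theorem abs_posInv_mul_ne_one (h : AdmissibleParams S c) {ρ : ℝ}
    (hne : ∀ k ∈ S, 0 < k → c k ≠ ρ) (k : ℤ) : |posInv S c k| * ρ ≠ 1 := by
  rw [abs_of_nonneg (h.posInv_nonneg k)]
  unfold posInv
  split_ifs with hk
  · rw [Ne, inv_mul_eq_one₀ (h.pos k hk.1 hk.2.ne').ne']
    exact hne k hk.1 hk.2
  · simp

theorem abs_negInv_mul_ne_one (h : AdmissibleParams S c) {ρ : ℝ} (hρ : 0 < ρ)
    (hne : ∀ k ∈ S, k < 0 → (c k)⁻¹ ≠ ρ) (k : ℤ) : |negInv S c k| * ρ⁻¹ ≠ 1 := by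
  rw [abs_of_nonneg (h.negInv_nonneg k)]
  unfold negInv
  split_ifs with hk
  · rw [Ne, mul_inv_eq_one₀ hρ.ne']
    exact hne k hk.1 hk.2
  · simp

theorem differentiableAt_linProd_inv {x : ℤ → ℝ} (hx : Summable x) {z : ℂ} (hz : z ≠ 0) :
    DifferentiableAt ℂ (fun w => linProd x w⁻¹) z :=
  (linProd_differentiable hx _).comp z (differentiableAt_inv hz)

end posInv

/-! ### The two representations of the ratio -/

open Classical in
theorem exists_factor_pos {M N : Set ℤ} {α β : ℤ → ℝ} (hM : AdmissibleParams M β)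
    (hN : AdmissibleParams N α) {k : ℤ} (hk : 0 < k) (hNM : k ∈ N → k ∈ M) :
    ∃ κ : ℝ, 0 ≤ κ ∧ ∀ z : ℂ, (1 + (posInv M β k : ℂ) * z) / (1 + (posInv N α k : ℂ) * z) =
      κ * ((if k ∈ M then z + (β k : ℂ) else 1) / if k ∈ M ∧ k ∈ N then z + (α k : ℂ) else 1) := by
  by_cases hkM : k ∈ M
  · have hβ := hM.pos k hkM hk.ne'
    have hβ' : (β k : ℂ) ≠ 0 := Complex.ofReal_ne_zero.2 hβ.ne'
    have e1 : ∀ z : ℂ, 1 + (posInv M β k : ℂ) * z = (β k : ℂ)⁻¹ * (z + β k) := fun z => by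
      unfold posInv
      rw [if_pos ⟨hkM, hk⟩]
      push_cast
      rw [mul_add, inv_mul_cancel₀ hβ', add_comm]
    by_cases hkN : k ∈ N
    · have hα := hN.pos k hkN hk.ne'
      have hα' : (α k : ℂ) ≠ 0 := Complex.ofReal_ne_zero.2 hα.ne'
      have e2 : ∀ z : ℂ, 1 + (posInv N α k : ℂ) * z = (α k : ℂ)⁻¹ * (z + α k) := fun z => by
        unfold posInv
        rw [if_pos ⟨hkN, hk⟩]
        push_cast
        rw [mul_add, inv_mul_cancel₀ hα', add_comm]
      refine ⟨α k / β k, by positivity, fun z => ?_⟩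
      rw [e1, e2, if_pos hkM, if_pos ⟨hkM, hkN⟩, mul_div_mul_comm]
      push_cast
      congr 1
      field_simp
    · refine ⟨(β k)⁻¹, by positivity, fun z => ?_⟩
      rw [e1, if_pos hkM, if_neg fun h => hkN h.2]
      simp [posInv, hkN]
  · have hkN : k ∉ N := fun h => hkM (hNM h)
    exact ⟨1, zero_le_one, fun z => by simp [posInv, hkM, hkN]⟩

-- Clearing z⁻¹ from numerator and denominator turns a pole factor without a partner into z/(z +
-- 1/α). The absent zero thus becomes a zero at the origin.
open Classical in
theorem exists_factor_neg {M N : Set ℤ} {α β : ℤ → ℝ} {k : ℤ} (hk : k < 0) (hMN : k ∈ M → k ∈ N)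
    {z : ℂ} (hz : z ≠ 0) :
    (1 + (negInv M β k : ℂ) * z⁻¹) / (1 + (negInv N α k : ℂ) * z⁻¹) =
      (if k ∈ N then z + ((if k ∈ M then (β k)⁻¹ else 0 : ℝ) : ℂ) else 1) /
        if k ∈ N then z + (((α k)⁻¹ : ℝ) : ℂ) else 1 := by
  by_cases hkN : k ∈ N
  · have e : ∀ t : ℝ, 1 + (t : ℂ) * z⁻¹ = z⁻¹ * (z + t) := fun t => by
      field_simp
    rw [e, e, mul_div_mul_left _ _ (inv_ne_zero hz)]
    unfold negInv
    simp [hkN, hk]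
  · have hkM : k ∉ M := fun h => hkN (hMN h)
    simp [negInv, hkN, hkM]

open Classical in
theorem hurwitzType_tnn_of_interlacingForm {a b : ℤ → ℝ} {p q F : ℂ → ℂ} {r R : ℝ} (hr : 0 ≤ r)
    (hrR : r < R) (ha : HasLaurentSeriesOn a p r R) (hb : HasLaurentSeriesOn b q r R)
    (hp : HasEdreiForm p r R) (hq : HasEdreiForm q r R) (hF : HasInterlacingForm F)
    (hquot : ∀ z ∈ annulus r R, p z ≠ 0 → q z / p z = F z) :
    TotallyNonnegative (hurwitzType a b) := by
  obtain ⟨C, M, N, β, α, hC, hM, hN, h1, h2, h3, h4, h5, hFz⟩ := hF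
  have hpos : ∀ {k l : ℤ}, 0 < k → k < l → l ∈ M → k ∈ N ∧ α k < β l := fun hk hkl hl =>
    interlacing_chain (L := 1) (fun n hn => h1 n (by omega)) (fun n hn => h2 n (by omega)) hk hkl hl
  have hneg : ∀ {k l : ℤ}, l < 0 → k < l → k ∈ N → l ∈ M ∧ (α k)⁻¹ < (β l)⁻¹ := fun hl hkl hk =>
    interlacing_chain_neg (α := fun k => (α k)⁻¹) (β := fun k => (β k)⁻¹) h3 h4 hl hkl hk
  -- One increasing chain is formed from both halves. For negative indices the pole decides
  -- presence, because a missing β is replaced by the zero 0.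
  set K : Set ℤ := {k | (0 < k ∧ k ∈ M) ∨ (k < 0 ∧ k ∈ N)}
  have hKpos : ∀ {k : ℤ}, 0 < k → (k ∈ K ↔ k ∈ M) := fun {k} hk =>
    ⟨fun h => h.elim (fun h => h.2) fun h => absurd h.1 hk.not_gt, fun h => Or.inl ⟨hk, h⟩⟩
  have hKneg : ∀ {k : ℤ}, k < 0 → (k ∈ K ↔ k ∈ N) := fun {k} hk =>
    ⟨fun h => h.elim (fun h => absurd h.1 hk.not_gt) fun h => h.2, fun h => Or.inr ⟨hk, h⟩⟩
  have hK0 : (0 : ℤ) ∉ K := fun h => h.elim (fun h => lt_irrefl _ h.1) fun h => lt_irrefl _ h.1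
  set α' : ℤ → ℝ := fun k => if 0 < k then α k else (α k)⁻¹ with hα'
  set β' : ℤ → ℝ := fun k => if 0 < k then β k else if k ∈ M then (β k)⁻¹ else 0 with hβ'
  have hα'pos : ∀ {k : ℤ}, 0 < k → α' k = α k := fun hk => if_pos hk
  have hα'neg : ∀ {k : ℤ}, k < 0 → α' k = (α k)⁻¹ := fun hk => if_neg hk.not_gt
  have hβ'pos : ∀ {k : ℤ}, 0 < k → β' k = β k := fun hk => if_pos hk
  have hβ'neg : ∀ {k : ℤ}, k < 0 → k ∈ M → β' k = (β k)⁻¹ := fun hk hkM => by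
    simp only [hβ']
    rw [if_neg hk.not_gt, if_pos hkM]
  have hIK : InterlacingParams K N α' β' := by
    refine ⟨fun k hk => ?_, fun k hk hkN => ?_, fun k hk l hl hkl => ?_⟩
    · rcases hk with ⟨hk, hkM⟩ | ⟨hk, hkN⟩
      · rw [hβ'pos hk]
        exact (hM.pos k hkM hk.ne').le
      · simp only [hβ', if_neg hk.not_gt]
        split_ifs with hkM
        · exact (inv_pos.2 (hM.pos k hkM hk.ne)).le
        · exact le_rfl
    · rcases hk with ⟨hk, -⟩ | ⟨hk, -⟩
      · rw [hβ'pos hk, hα'pos hk]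
        exact (h1 k hk hkN).2
      · rw [hα'neg hk]
        simp only [hβ', if_neg hk.not_gt]
        split_ifs with hkM
        · exact (h3 k hk hkM).2
        · exact inv_pos.2 (hN.pos k hkN hk.ne)
    · rcases hk with ⟨hk, -⟩ | ⟨hk, hkN⟩ <;> rcases hl with ⟨hl, hlM⟩ | ⟨hl, hlN⟩
      · rw [hα'pos hk, hβ'pos hl]
        exact hpos hk hkl hlM
      · omega
      · rw [hα'neg hk, hβ'pos hl]
        -- Comparing a negative with a positive index goes through the two middle terms 1/α_{-1} <
        -- β_1.
        have h6 : -1 ∈ N ∧ (α k)⁻¹ ≤ (α (-1))⁻¹ := by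
          rcases eq_or_ne k (-1) with rfl | hk1
          · exact ⟨hkN, le_rfl⟩
          · have h7 := hneg (l := -1) (by norm_num) (by omega) hkN
            have h8 := h3 (-1) (by norm_num) h7.1
            exact ⟨h8.1, (h7.2.trans h8.2).le⟩
        have h7 : 1 ∈ M ∧ β 1 ≤ β l := by
          rcases eq_or_ne l 1 with rfl | hl1
          · exact ⟨hlM, le_rfl⟩
          · have h7 := hpos (k := 1) (by norm_num) (by omega) hlM
            have h8 := h1 1 (by norm_num) h7.1
            exact ⟨h8.1, (h8.2.trans h7.2).le⟩
        exact ⟨hkN, h6.2.trans_lt ((h5 h6.1 h7.1).trans_le h7.2)⟩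
      · have h6 := hneg hl hkl hkN
        rw [hα'neg hk, hβ'neg hl h6.1]
        exact ⟨hkN, h6.2⟩
  have sM := hM.summable_posInv
  have sN := hN.summable_posInv
  have tM := hM.summable_negInv
  have tN := hN.summable_negInv
  refine hurwitzType_tnn_of_ratio hr hrR ha hb hp hq hquot hIK
    (P := fun z => linProd (posInv N α) z * linProd (negInv N α) z⁻¹)
    (Q := fun z => C * (linProd (posInv M β) z * linProd (negInv M β) z⁻¹))
    (fun z hz => (linProd_differentiable sN z).mul (differentiableAt_linProd_inv tN hz))
    (fun z hz => ((linProd_differentiable sM z).mul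
      (differentiableAt_linProd_inv tM hz)).const_mul _)
    (fun z hz => ?_) (fun z hz => ?_) (fun k hk hkN => ?_)
    (S := fun s z => C * (((∏ k ∈ s, (1 + (posInv M β k : ℂ) * z)) /
      ∏ k ∈ s, (1 + (posInv N α k : ℂ) * z)) * ((∏ k ∈ s, (1 + (negInv M β k : ℂ) * z⁻¹)) /
      ∏ k ∈ s, (1 + (negInv N α k : ℂ) * z⁻¹)))) (fun s => ?_) (fun ρ hρ hne => ?_)
    fun z hz hPz => ?_
  · rw [hFz z hz, posProd_eq_linProd, posProd_eq_linProd, negProd_eq_linProd, negProd_eq_linProd,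
      mul_assoc, ← mul_div_mul_comm, ← mul_div_assoc]
  · rw [mul_eq_zero, linProd_posInv_eq_zero_iff hN, linProd_negInv_eq_zero_iff hN]
    constructor
    · rintro (⟨k, hkN, hk, h⟩ | ⟨k, hkN, hk, h⟩)
      · exact ⟨k, (hKpos hk).2 (h1 k hk hkN).1, hkN, by rw [hα'pos hk, h]⟩
      · exact ⟨k, (hKneg hk).2 hkN, hkN, by rw [hα'neg hk, h]⟩
    · rintro ⟨k, hk, hkN, h⟩
      rcases hk with ⟨hk, -⟩ | ⟨hk, -⟩
      · exact Or.inl ⟨k, hkN, hk, by rw [h, hα'pos hk]⟩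
      · exact Or.inr ⟨k, hkN, hk, by rw [h, hα'neg hk]⟩
  · refine mul_ne_zero (Complex.ofReal_ne_zero.2 hC.ne') (mul_ne_zero ?_ ?_)
    · rw [Ne, linProd_posInv_eq_zero_iff hM]
      rintro ⟨l, hlM, hl, h⟩
      rw [neg_inj, Complex.ofReal_inj, ← hβ'pos hl] at h
      exact hIK.ne hk hkN ((hKpos hl).2 hlM) h.symm
    · rw [Ne, linProd_negInv_eq_zero_iff hM]
      rintro ⟨l, hlM, hl, h⟩
      rw [neg_inj, Complex.ofReal_inj, ← hβ'neg hl hlM] at h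
      exact hIK.ne hk hkN ((hKneg hl).2 (h3 l hl hlM).1) h.symm
  · have hfac : ∀ k, ∃ κ : ℝ, 0 ≤ κ ∧ ∀ z : ℂ, z ≠ 0 →
        ((1 + (posInv M β k : ℂ) * z) / (1 + (posInv N α k : ℂ) * z)) *
        ((1 + (negInv M β k : ℂ) * z⁻¹) / (1 + (negInv N α k : ℂ) * z⁻¹)) =
        κ * ((if k ∈ K then z + (β' k : ℂ) else 1) /
          if k ∈ K ∧ k ∈ N then z + (α' k : ℂ) else 1) := by
      intro k
      rcases lt_trichotomy k 0 with hk | rfl | hk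
      · refine ⟨1, zero_le_one, fun z hz => ?_⟩
        rw [exists_factor_neg hk (fun h => (h3 k hk h).1) hz, hα'neg hk]
        simp only [hKneg hk, and_self, hβ', if_neg hk.not_gt]
        simp [posInv, hk.not_gt]
      · refine ⟨1, zero_le_one, fun z hz => ?_⟩
        simp [posInv, negInv, hK0]
      · obtain ⟨κ, hκ, h⟩ := exists_factor_pos hM hN hk fun h => (h1 k hk h).1
        refine ⟨κ, hκ, fun z _ => ?_⟩
        rw [h, hα'pos hk, hβ'pos hk]
        simp only [hKpos hk]
        simp [negInv, hk.not_gt]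
    choose κ hκ hfac using hfac
    refine ⟨C * ∏ k ∈ s, κ k, mul_nonneg hC.le (Finset.prod_nonneg fun k _ => hκ k), s,
      fun z hz => ?_⟩
    rw [← Finset.prod_div_distrib, ← Finset.prod_div_distrib, ← Finset.prod_mul_distrib,
      Finset.prod_congr rfl fun k _ => hfac k z hz, Finset.prod_mul_distrib]
    push_cast
    rw [mul_assoc]
    congr!
  · obtain ⟨B₁, hB₁⟩ := exists_bound_prod_div sM sN (r := ρ) (abs_posInv_mul_ne_one hN
      fun k hkN hk => by
        rw [← hα'pos hk]
        exact hne k ((hKpos hk).2 (h1 k hk hkN).1) hkN)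
    obtain ⟨B₂, hB₂⟩ := exists_bound_prod_div tM tN (r := ρ⁻¹) (abs_negInv_mul_ne_one hN hρ
      fun k hkN hk => by
        rw [← hα'neg hk]
        exact hne k ((hKneg hk).2 hkN) hkN)
    refine ⟨C * (B₁ * B₂), (hB₁.and hB₂).mono fun s hs z hz => ?_⟩
    have h6 := hs.1 z (mem_sphere_zero_iff_norm.1 hz)
    have h7 := hs.2 z⁻¹ (norm_inv_eq_of_mem_sphere hz)
    rw [norm_mul, norm_mul, Complex.norm_real, Real.norm_of_nonneg hC.le]
    exact mul_le_mul_of_nonneg_left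
      (mul_le_mul h6 h7 (norm_nonneg _) ((norm_nonneg _).trans h6)) hC.le
  · rw [hFz z hz, posProd_eq_linProd, posProd_eq_linProd, negProd_eq_linProd, negProd_eq_linProd,
      mul_assoc]
    exact ((prod_div_tendsto sM sN (left_ne_zero_of_mul hPz)).mul
      (prod_div_tendsto tM tN (right_ne_zero_of_mul hPz))).const_mul _

open Classical in
theorem hurwitzType_tnn_of_meromorphicInterlacingForm {a b : ℤ → ℝ} {p q F : ℂ → ℂ} {r R : ℝ}
    (hr : 0 ≤ r) (hrR : r < R) (ha : HasLaurentSeriesOn a p r R) (hb : HasLaurentSeriesOn b q r R)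
    (hp : HasEdreiForm p r R) (hq : HasEdreiForm q r R) (hF : HasMeromorphicInterlacingForm F)
    (hquot : ∀ z ∈ annulus r R, p z ≠ 0 → q z / p z = F z) :
    TotallyNonnegative (hurwitzType a b) := by
  obtain ⟨C, M, N, β, α, hC, hM, hN, h0M, h0N, hβ0, h1, h2, hFz⟩ := hF
  set K : Set ℤ := {k | 0 ≤ k ∧ k ∈ M}
  have hchain : ∀ {k l : ℤ}, 0 ≤ k → k < l → l ∈ M → k ∈ N ∧ α k < β l := fun hk hkl hl =>
    interlacing_chain h1 h2 hk hkl hl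
  have hIK : InterlacingParams K N α β := by
    refine ⟨fun k hk => ?_, fun k hk hkN => (h1 k hk.1 hkN).2, fun k hk l hl hkl =>
      hchain hk.1 hkl hl.2⟩
    rcases eq_or_ne k 0 with rfl | h0
    · exact hβ0
    · exact (hM.pos k hk.2 h0).le
  have h0K : (0 : ℤ) ∈ K := ⟨le_rfl, h0M⟩
  have hKpos : ∀ {k : ℤ}, 0 < k → (k ∈ K ↔ k ∈ M) := fun {k} hk =>
    ⟨fun h => h.2, fun h => ⟨hk.le, h⟩⟩
  have hα0 : 0 < α 0 := hIK.pos h0K h0N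
  -- If C = 0, then q would vanish at a nonreal point of the annulus, where a function of Edrei's
  -- form is nonzero.
  have hCpos : 0 < C := by
    refine hC.lt_of_ne fun hC0 => ?_
    obtain ⟨e, -, -, he⟩ := hp
    obtain ⟨e', -, -, he'⟩ := hq
    have hpos : 0 < (r + R) / 2 := by linarith
    set z : ℂ := ((r + R) / 2 : ℝ) * Complex.I with hz
    have him : z.im ≠ 0 := by
      rw [hz]
      simpa using hpos.ne'
    have hnorm : ‖z‖ = (r + R) / 2 := by
      rw [hz, norm_mul, Complex.norm_I, mul_one, Complex.norm_real, Real.norm_of_nonneg hpos.le]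
    have hzA : z ∈ annulus r R := ⟨by rw [hnorm]; linarith, by rw [hnorm]; linarith⟩
    have hz0 : z ≠ 0 := by
      intro h
      rw [h] at him
      simp at him
    have hpz : p z ≠ 0 := by
      rw [he z hzA]
      exact e.eval_ne_zero_of_im_ne_zero him
    have hqz : q z ≠ 0 := by
      rw [he' z hzA]
      exact e'.eval_ne_zero_of_im_ne_zero him
    have := hquot z hzA hpz
    rw [hFz z hz0, ← hC0] at this
    simp [hpz, hqz] at this
  have sM := hM.summable_posInv
  have sN := hN.summable_posInv
  refine hurwitzType_tnn_of_ratio hr hrR ha hb hp hq hquot hIK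
    (P := fun z => (z + (α 0 : ℂ)) * linProd (posInv N α) z)
    (Q := fun z => C * ((z + (β 0 : ℂ)) * linProd (posInv M β) z))
    (fun z _ => (differentiableAt_id.add_const _).mul (linProd_differentiable sN z))
    (fun z _ => ((differentiableAt_id.add_const _).mul (linProd_differentiable sM z)).const_mul _)
    (fun z hz => ?_) (fun z hz => ?_) (fun k hk hkN => ?_)
    (S := fun s z => C * (((z + (β 0 : ℂ)) / (z + (α 0 : ℂ))) *
      ((∏ k ∈ s, (1 + (posInv M β k : ℂ) * z)) / ∏ k ∈ s, (1 + (posInv N α k : ℂ) * z))))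
    (fun s => ?_) (fun ρ hρ hne => ?_) fun z hz hPz => ?_
  · rw [hFz z hz, posProd_eq_linProd, posProd_eq_linProd, mul_assoc, ← mul_div_mul_comm,
      ← mul_div_assoc]
  · rw [mul_eq_zero, linProd_posInv_eq_zero_iff hN]
    constructor
    · rintro (h | ⟨k, hkN, hk, h⟩)
      · exact ⟨0, h0K, h0N, eq_neg_of_add_eq_zero_left h⟩
      · exact ⟨k, (hKpos hk).2 (h1 k hk.le hkN).1, hkN, h⟩
    · rintro ⟨k, hk, hkN, h⟩
      rcases hk.1.eq_or_lt with rfl | hk0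
      · left
        rw [h]
        ring
      · exact Or.inr ⟨k, hkN, hk0, h⟩
  · refine mul_ne_zero (Complex.ofReal_ne_zero.2 hCpos.ne') (mul_ne_zero ?_ ?_)
    · rw [Ne, neg_add_eq_zero, Complex.ofReal_inj]
      exact fun h => hIK.ne hk hkN h0K h.symm
    · rw [Ne, linProd_posInv_eq_zero_iff hM]
      rintro ⟨l, hlM, hl, h⟩
      rw [neg_inj, Complex.ofReal_inj] at h
      exact hIK.ne hk hkN ((hKpos hl).2 hlM) h.symm
  · have hfac : ∀ k, ∃ κ : ℝ, 0 ≤ κ ∧ (k ≠ 0 → ∀ z : ℂ,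
        (1 + (posInv M β k : ℂ) * z) / (1 + (posInv N α k : ℂ) * z) =
        κ * ((if k ∈ K then z + (β k : ℂ) else 1) /
          if k ∈ K ∧ k ∈ N then z + (α k : ℂ) else 1)) := by
      intro k
      rcases lt_trichotomy k 0 with hk | rfl | hk
      · refine ⟨1, zero_le_one, fun _ z => ?_⟩
        have hkK : k ∉ K := fun h => absurd h.1 hk.not_ge
        simp [posInv, hkK, hk.not_gt]
      · exact ⟨1, zero_le_one, fun h => absurd rfl h⟩
      · obtain ⟨κ, hκ, h⟩ := exists_factor_pos hM hN hk fun h => (h1 k hk.le h).1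
        refine ⟨κ, hκ, fun _ z => ?_⟩
        rw [h]
        simp only [hKpos hk]
    choose κ hκ hfac using hfac
    -- The approximants carry the factor of index 0 for every `s`; hence 0 is removed from `s` and
    -- inserted once.
    refine ⟨C * ∏ k ∈ s.erase 0, κ k, mul_nonneg hC (Finset.prod_nonneg fun k _ => hκ k),
      insert 0 (s.erase 0), fun z hz => ?_⟩
    have h3 : (1 + (posInv M β 0 : ℂ) * z) / (1 + (posInv N α 0 : ℂ) * z) = 1 := by simp [posInv]
    rw [← Finset.prod_div_distrib, ← Finset.prod_erase s h3,
      Finset.prod_insert (Finset.notMem_erase _ _), if_pos h0K, if_pos ⟨h0K, h0N⟩,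
      Finset.prod_congr rfl fun k hk => hfac k (Finset.ne_of_mem_erase hk) z,
      Finset.prod_mul_distrib]
    push_cast
    rw [mul_left_comm ((z + (β 0 : ℂ)) / _), mul_assoc]
    congr!
  · obtain ⟨B₁, hB₁⟩ := exists_bound_prod_div sM sN (r := ρ) (abs_posInv_mul_ne_one hN
      fun k hkN hk => hne k ((hKpos hk).2 (h1 k hk.le hkN).1) hkN)
    have hcont : ContinuousOn (fun z : ℂ => (z + (β 0 : ℂ)) / (z + (α 0 : ℂ))) (sphere 0 ρ) := by
      refine ContinuousOn.div (by fun_prop) (by fun_prop) fun z hz h => hne 0 h0K h0N ?_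
      have h3 := mem_sphere_zero_iff_norm.1 hz
      rwa [eq_neg_of_add_eq_zero_left h, norm_neg, Complex.norm_real,
        Real.norm_of_nonneg hα0.le] at h3
    obtain ⟨B₂, hB₂⟩ := (isCompact_sphere (0 : ℂ) ρ).exists_bound_of_continuousOn hcont
    refine ⟨C * (B₂ * B₁), hB₁.mono fun s hs z hz => ?_⟩
    rw [norm_mul, norm_mul, Complex.norm_real, Real.norm_of_nonneg hC]
    exact mul_le_mul_of_nonneg_left (mul_le_mul (hB₂ z hz) (hs z (mem_sphere_zero_iff_norm.1 hz))
      (norm_nonneg _) ((norm_nonneg _).trans (hB₂ z hz))) hC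
  · rw [hFz z hz, posProd_eq_linProd, posProd_eq_linProd, mul_assoc]
    exact ((prod_div_tendsto sM sN (right_ne_zero_of_mul hPz)).const_mul _).const_mul _

theorem mainTheorem5 (a b : ℤ → ℝ) (p q F : ℂ → ℂ) (r R : ℝ) (hr : 0 ≤ r) (hrR : r < R)
    (ha : HasLaurentSeriesOn a p r R) (hb : HasLaurentSeriesOn b q r R)
    (hp : HasEdreiForm p r R)
    (hq : HasEdreiForm q r R ∨ ∀ z ∈ annulus r R, q z = 0)
    (hF : HasInterlacingForm F ∨ HasMeromorphicInterlacingForm F)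
    (hquot : ∀ z ∈ annulus r R, p z ≠ 0 → q z / p z = F z) :
    TotallyNonnegative (hurwitzType a b) := by
  rcases hq with hq | hq
  · rcases hF with hF | hF
    · exact hurwitzType_tnn_of_interlacingForm hr hrR ha hb hp hq hF hquot
    · exact hurwitzType_tnn_of_meromorphicInterlacingForm hr hrR ha hb hp hq hF hquot
  · exact hurwitzType_zero_tnn hr hrR ha hb hp hq
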